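/- Let \(G=(V,E)\) be a finite simple graph with vertex capacities \(b:V\to\mathbb Z_{\ge 0}\) and edge weights \(w:E\to\mathbb R\), and let \(\delta(v)\) be the set of edges incident to \(v\). A fractional \(b\)-matching is a vector \(x\in\mathbb R_{\ge0}^E\) with \(\sum_{e\in\delta(v)}x_e\le b_v\) for all \(v\in V\); it is a \(b\)-matching if it is integral, and maximum if it maximizes \(\sum_{e\in E} w_ex_e\) among the fractional \(b\)-matchings. A fractional \(w\)-cover is a vector \(y\in\mathbb R_{\ge0}^V\) with \(y_i+y_j\ge w_{ij}\) for all \(ij\in E\); it is minimum if it minimizes \(\sum_{i\in V}b_iy_i\). For \(S\subseteq V\), let \(\gamma(S)\) be the maximum weight of a \(b\)-matching in the induced subgraph \(G[S]\); this defines the multiple partners matching (\(b\)-matching) game on \(G\). For \(0<\alpha\le1\), a vector \(a\in\mathbb R_{\ge0}^V\) lies in the \(\alpha\)-approximate core of this game if \(\sum_{i\in V}a_i\le\gamma(V)\) and \(\sum_{i\in S}a_i\ge\alpha\,\gamma(S)\) for all \(S\subseteq V\). Mechanism. (1) Take a half-integral maximum fractional \(b\)-matching \(x\) (that is, \(2x\)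 is integral) and a minimum fractional \(w\)-cover \(y\). (2) Modify \(x\), keeping it a half-integral maximum fractional \(b\)-matching, so that its non-integral edges form a family \(\mathcal C\) of vertex-disjoint odd cycles. (3) Output the vector \(a\) with \(a_i=\bigl(1-\tfrac1{l_C b_i}\bigr)b_iy_i\) if \(i\) lies on a cycle \(C\in\mathcal C\) of length \(l_C\), and \(a_i=b_iy_i\) if \(i\) lies on no cycle of \(\mathcal C\). Then the following hold. (i) A half-integral maximum fractional \(b\)-matching and a minimum fractional \(w\)-cover exist. (ii) Every half-integral maximum fractional \(b\)-matching can be modified as in (2) by a finite sequence of operations of the following kind: choose a trail in the graph formed by the current non-integral edges that either joins two distinct vertices of odd degree in that graph or is closed of even length, and change the values along its successive edges alternately by \(-\tfrac12,+\tfrac12,-\tfrac12,\dots\). (iii) For every \(x\) and \(\mathcal C\) that can result from (2), and every minimum fractional \(w\)-cover \(y\), the output \(a\) lies in the \(\bigl(1-\tfrac1{l'b'}\bigr)\)-approximate core of the game, where \(l'=\min_{C\in\mathcal C}l_C\) and \(b'=\min_{C\in\mathcal C}\min_{v\in C}b_v\). (iv) If moreover \(b_v\ge1\) for all \(v\in V\),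 then every such \(a\) lies in the \(\bigl(1-\tfrac1{l_{\min}b_{\min}}\bigr)\)-approximate core of the game, where \(l_{\min}\) is the minimum length of an odd cycle of \(G\) and \(b_{\min}=\min_{v\in V}b_v\). Here a minimum over the empty set is \(\infty\) and \(1/\infty=0\), so the factor is \(1\) when \(\mathcal C\) is empty, respectively when \(G\) has no odd cycle. -/

import Mathlib

open scoped ENNReal

namespace BMatchingGame

variable {V : Type*} [Fintype V]

/-! Vectors indexed by the edges of a graph `H` on `V` are represented by functions on `Sym2 V`;
values at elements of `Sym2 V` that are not edges of `H` are never used. -/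

open scoped Classical in
/-- The weight `w(H, x) = ∑_{e ∈ E(H)} w_e x_e`. -/
noncomputable def weight (H : SimpleGraph V) (w x : Sym2 V → ℝ) : ℝ :=
  ∑ e ∈ H.edgeFinset, w e * x e

open scoped Classical in
/-- The load `∑_{e ∈ δ(v)} x_e` of a vertex `v`. -/
noncomputable def load (H : SimpleGraph V) (x : Sym2 V → ℝ) (v : V) : ℝ :=
  ∑ e ∈ H.edgeFinset with v ∈ e, x e

/-- Fractional `b`-matchings of `H`: the feasible solutions of the primal linear program. -/
def IsFractionalBMatching (H : SimpleGraph V) (b : V → ℕ) (x : Sym2 V → ℝ) : Prop :=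
  (∀ v, load H x v ≤ b v) ∧ ∀ e ∈ H.edgeSet, 0 ≤ x e

/-- (Integral) `b`-matchings of `H`. -/
def IsBMatching (H : SimpleGraph V) (b : V → ℕ) (z : Sym2 V → ℤ) : Prop :=
  IsFractionalBMatching H b (fun e => (z e : ℝ))

/-- Maximum fractional `b`-matchings: the optimal solutions of the primal linear program. -/
def IsMaxFractionalBMatching (H : SimpleGraph V) (b : V → ℕ) (w x : Sym2 V → ℝ) : Prop :=
  IsFractionalBMatching H b x ∧
    ∀ x' : Sym2 V → ℝ, IsFractionalBMatching H b x' → weight H w x' ≤ weight H w x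

/-- Fractional `w`-covers of `H`: the feasible solutions of the dual linear program. -/
def IsFractionalCover (H : SimpleGraph V) (w : Sym2 V → ℝ) (y : V → ℝ) : Prop :=
  (∀ i j, H.Adj i j → w s(i, j) ≤ y i + y j) ∧ ∀ i, 0 ≤ y i

/-- Minimum fractional `w`-covers: the optimal solutions of the dual linear program. -/
def IsMinFractionalCover (H : SimpleGraph V) (b : V → ℕ) (w : Sym2 V → ℝ) (y : V → ℝ) : Prop :=
  IsFractionalCover H w y ∧
    ∀ y' : V → ℝ, IsFractionalCover H w y' → ∑ i, (b i : ℝ) * y i ≤ ∑ i, (b i : ℝ) * y' i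

/-! ### The game -/

/-- The induced subgraph `G[S]`, kept on the vertex type `V`: the vertices outside `S` become
isolated, which affects neither the `b`-matchings nor their weights. -/
def inducedSubgraph (G : SimpleGraph V) (S : Set V) : SimpleGraph V where
  Adj u v := G.Adj u v ∧ u ∈ S ∧ v ∈ S
  symm := ⟨fun _ _ h => ⟨h.1.symm, h.2.2, h.2.1⟩⟩
  loopless := ⟨fun _ h => h.1.ne rfl⟩

/-- The set of weights of the `b`-matchings of `H`. -/
def matchingWeights (H : SimpleGraph V) (b : V → ℕ) (w : Sym2 V → ℝ) : Set ℝ :=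
  {r | ∃ z : Sym2 V → ℤ, IsBMatching H b z ∧ weight H w (fun e => (z e : ℝ)) = r}

/-- The characteristic function `γ` of the `b`-matching game: `γ(S)` is the weight of a maximum
`b`-matching in `G[S]` (the supremum is a maximum, see `gamma_isGreatest`). -/
noncomputable def gamma (G : SimpleGraph V) (b : V → ℕ) (w : Sym2 V → ℝ) (S : Set V) : ℝ :=
  sSup (matchingWeights (inducedSubgraph G S) b w)

/-- A vector `a` is an allocation in the `α`-approximate core (`0 < α ≤ 1`) of the `b`-matching
game on `G`. -/
structure InApproxCore (G : SimpleGraph V) (b : V → ℕ) (w : Sym2 V → ℝ) (α : ℝ) (a : V → ℝ) :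
    Prop where
  factor_pos : 0 < α
  factor_le_one : α ≤ 1
  nonneg : ∀ i, 0 ≤ a i
  grand : ∑ i, a i ≤ gamma G b w Set.univ
  coalition : ∀ S : Finset V, α * gamma G b w S ≤ ∑ i ∈ S, a i

/-! ### Odd cycles and non-integral edges -/

/-- A subgraph of `G` is an odd cycle. -/
def IsOddCycle {G : SimpleGraph V} (C : G.Subgraph) : Prop :=
  ∃ (v : V) (p : G.Walk v v), p.IsCycle ∧ Odd p.length ∧ C = p.toSubgraph

/-- The length of a cycle: its number of edges. -/
noncomputable def cycleLength {G : SimpleGraph V} (C : G.Subgraph) : ℕ := C.edgeSet.ncard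

/-- A real number is integral. -/
def IsInteger (r : ℝ) : Prop := ∃ n : ℤ, r = n

/-- An edge vector `x` is half-integral: `2x` is integral. -/
def IsHalfIntegral (G : SimpleGraph V) (x : Sym2 V → ℝ) : Prop :=
  ∀ e ∈ G.edgeSet, IsInteger (2 * x e)

/-- The subgraph `G'` formed by the non-integral edges of `x`. -/
def nonIntegralGraph (G : SimpleGraph V) (x : Sym2 V → ℝ) : SimpleGraph V where
  Adj u v := G.Adj u v ∧ ¬ IsInteger (x s(u, v))
  symm := ⟨fun u v h => ⟨h.1.symm, by rw [Sym2.eq_swap]; exact h.2⟩⟩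
  loopless := ⟨fun _ h => h.1.ne rfl⟩

/-- The non-integral edges of `x` form vertex-disjoint odd cycles, namely those in `𝒞`. -/
structure NonIntegralCycles (G : SimpleGraph V) (x : Sym2 V → ℝ) (𝒞 : Set G.Subgraph) :
    Prop where
  oddCycle : ∀ C ∈ 𝒞, IsOddCycle C
  disjoint : ∀ C ∈ 𝒞, ∀ D ∈ 𝒞, C ≠ D → Disjoint C.verts D.verts
  edges : ∀ e ∈ G.edgeSet, ¬ IsInteger (x e) ↔ ∃ C ∈ 𝒞, e ∈ C.edgeSet

/-! ### The mechanism -/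

open scoped Classical in
/-- The result of changing `x` alternately by `-1/2, +1/2, -1/2, …` along the edges
`e₁, e₂, e₃, …` of a list without repetition. -/
noncomputable def alternate (x : Sym2 V → ℝ) (T : List (Sym2 V)) (e : Sym2 V) : ℝ :=
  if e ∈ T then (if Even (T.idxOf e) then x e - 1 / 2 else x e + 1 / 2) else x e

/-- One modification step: `x'` arises from `x` by the alternating operation along a trail of
non-integral edges that either joins two distinct vertices of odd degree in the graph of
non-integral edges or is closed of even length. -/
def ModifyStep (G : SimpleGraph V) (x x' : Sym2 V → ℝ) : Prop :=
  ∃ (u v : V) (p : (nonIntegralGraph G x).Walk u v), p.IsTrail ∧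
    ((u ≠ v ∧ Odd ((nonIntegralGraph G x).neighborSet u).ncard ∧
        Odd ((nonIntegralGraph G x).neighborSet v).ncard) ∨
      (u = v ∧ Even p.length)) ∧
    x' = alternate x p.edges

open scoped Classical in
/-- The output of the mechanism: a vertex `i` on a non-integral odd cycle `C` (unique, as the
cycles in `𝒞` are disjoint) gets `(1 - 1/(l_C b_i)) b_i y_i`, any other vertex gets `b_i y_i`. -/
noncomputable def allocation {G : SimpleGraph V} (b : V → ℕ) (y : V → ℝ) (𝒞 : Set G.Subgraph)
    (i : V) : ℝ :=
  if h : ∃ C ∈ 𝒞, i ∈ C.verts then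
    (1 - 1 / ((cycleLength h.choose : ℝ) * b i)) * (b i * y i)
  else b i * y i

/-! ### The approximation factors -/

/-- The minimum length of the cycles in `𝒞` (`⊤` if `𝒞` is empty). -/
noncomputable def minLength {G : SimpleGraph V} (𝒞 : Set G.Subgraph) : ℕ∞ :=
  ⨅ C ∈ 𝒞, (cycleLength C : ℕ∞)

/-- The minimum capacity of a vertex on a cycle in `𝒞` (`⊤` if `𝒞` is empty). -/
noncomputable def minCapacityOn {G : SimpleGraph V} (b : V → ℕ) (𝒞 : Set G.Subgraph) : ℕ∞ :=
  ⨅ C ∈ 𝒞, ⨅ v ∈ C.verts, (b v : ℕ∞)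

/-- The minimum length of an odd cycle of `G` (`⊤` if `G` is bipartite). -/
noncomputable def minOddCycleLength (G : SimpleGraph V) : ℕ∞ :=
  minLength {C : G.Subgraph | IsOddCycle C}

/-- The minimum capacity of a vertex (`⊤` if there is no vertex). -/
noncomputable def minCapacity (b : V → ℕ) : ℕ∞ := ⨅ v, (b v : ℕ∞)

/-- The factor `1 - 1/(l β)`, with the convention `1/∞ = 0`. -/
noncomputable def factor (l β : ℕ∞) : ℝ := 1 - ((((l * β : ℕ∞) : ℝ≥0∞))⁻¹).toReal

/-! ### `γ` is a maximum -/

theorem le_of_isBMatching {H : SimpleGraph V} {b : V → ℕ} {z : Sym2 V → ℤ}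
    (hz : IsBMatching H b z) {e : Sym2 V} (he : e ∈ H.edgeSet) : z e ≤ ∑ v, (b v : ℤ) := by
  classical
  induction e with
  | _ u v =>
    have h1 : (z s(u, v) : ℝ) ≤ load H (fun e => (z e : ℝ)) u := by
      unfold load
      refine Finset.single_le_sum (f := fun e => (z e : ℝ)) (fun e' he' => ?_) ?_
      · simp only [Finset.mem_filter, SimpleGraph.mem_edgeFinset] at he'
        exact hz.2 e' he'.1
      · simpa using he
    have h2 : z s(u, v) ≤ (b u : ℤ) := by exact_mod_cast h1.trans (hz.1 u)
    exact h2.trans (Finset.single_le_sum (f := fun v => (b v : ℤ)) (fun _ _ => by positivity)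
      (Finset.mem_univ u))

theorem matchingWeights_finite (H : SimpleGraph V) (b : V → ℕ) (w : Sym2 V → ℝ) :
    (matchingWeights H b w).Finite := by
  classical
  refine (Set.finite_range (fun f : Sym2 V → Fin ((∑ v, b v) + 1) =>
    weight H w (fun e => ((f e : ℕ) : ℝ)))).subset ?_
  rintro r ⟨z, hz, rfl⟩
  refine ⟨fun e => Fin.ofNat _ (z e).toNat, ?_⟩
  refine Finset.sum_congr rfl fun e he => ?_
  have he' : e ∈ H.edgeSet := by simpa using he
  have h0 : 0 ≤ z e := by
    have h : (0 : ℝ) ≤ (z e : ℝ) := hz.2 e he'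
    exact_mod_cast h
  have h1 := le_of_isBMatching hz he'
  have h2 : (z e).toNat < (∑ v, b v) + 1 := by
    have : ((∑ v, b v : ℕ) : ℤ) = ∑ v, (b v : ℤ) := by push_cast; rfl
    omega
  have h3 : (((Fin.ofNat ((∑ v, b v) + 1) (z e).toNat : Fin _) : ℕ)) = (z e).toNat :=
    Nat.mod_eq_of_lt h2
  have h4 : (((z e).toNat : ℕ) : ℝ) = (z e : ℝ) := by
    have : (((z e).toNat : ℕ) : ℤ) = z e := Int.toNat_of_nonneg h0
    exact_mod_cast this
  simp only [h3, h4]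

theorem matchingWeights_nonempty (H : SimpleGraph V) (b : V → ℕ) (w : Sym2 V → ℝ) :
    (matchingWeights H b w).Nonempty :=
  ⟨_, fun _ => 0, ⟨by simp [load], by simp⟩, rfl⟩

/-- `γ(S)` is the largest weight of a `b`-matching in `G[S]`. -/
theorem gamma_isGreatest (G : SimpleGraph V) (b : V → ℕ) (w : Sym2 V → ℝ) (S : Set V) :
    IsGreatest (matchingWeights (inducedSubgraph G S) b w) (gamma G b w S) :=
  ⟨(matchingWeights_nonempty _ b w).csSup_mem (matchingWeights_finite _ b w),
    fun _ hr => le_csSup (matchingWeights_finite _ b w).bddAbove hr⟩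

end BMatchingGame

/-
By linear programming duality (from Farkas' lemma) the weight of a maximum fractional `b`-matching
`x` equals the value of a minimum fractional cover `y`, and `w` is the sum of the two values of `y`
on every edge with `x e > 0`.

At an extreme point of the polytope of fractional `b`-matchings no nonzero vector supported on the
non-integral edges has zero load at all saturated vertices. Counting dimensions, a saturated vertex
that meets a non-integral edge meets exactly two of them. Replacing the fractional parts by `1/2`
then leaves the loads of the saturated vertices unchanged, so the fractional parts are `1/2`.

Adding and subtracting the alternating vector of a modification trail keeps a half-integral optimum
feasible, because the load of a vertex of odd degree in the graph of non-integral edges lies in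
`ℤ + 1/2` and so is not tight. Both results are therefore optimal. When no nonempty modification
trail is left, all degrees are even, and none exceeds two since a vertex of larger degree is on two
edge-disjoint cycles, one of which is even or which together form an even closed trail.

Along an odd cycle, the alternating vector starting at `v` rounds `x`, lowers the load of `v` by `1`
and costs the weight `y v`. Choosing `v` with `y v` at most the mean of `y` over the cycle, this is
at most what the mechanism withholds from the cycle, so a `b`-matching pays for the allocation.
-/

namespace BMatchingGame

section LinearProgramming

theorem sum_insert_update_smul {R M ι : Type*} [Semiring R] [AddCommMonoid M] [Module R M]
    [DecidableEq ι] {s : Finset ι} {m : ι} (hm : m ∉ s) (u : ι → R) (t : R) (A : ι → M) :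
    ∑ i ∈ insert m s, Function.update u m t i • A i = t • A m + ∑ i ∈ s, u i • A i := by
  rw [Finset.sum_insert hm, Function.update_self]
  congr 1
  exact Finset.sum_congr rfl fun i hi => by
    rw [Function.update_of_ne (ne_of_mem_of_not_mem hi hm)]

variable {𝕜 E ι : Type*} [Field 𝕜] [LinearOrder 𝕜] [IsStrictOrderedRing 𝕜] [AddCommGroup E]
  [Module 𝕜 E]

theorem exists_nonneg_eq_sum_smul_of_forall_nonpos (A : ι → Module.Dual 𝕜 E)
    (c : Module.Dual 𝕜 E) (s : Finset ι) (h : ∀ x, (∀ i ∈ s, A i x ≤ 0) → c x ≤ 0) :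
    ∃ u : ι → 𝕜, 0 ≤ u ∧ c = ∑ i ∈ s, u i • A i := by
  classical
  induction s using Finset.induction_on generalizing A c with
  | empty =>
    refine ⟨0, le_rfl, LinearMap.ext fun x => le_antisymm (h x (by simp)) ?_⟩
    simpa using h (-x) (by simp)
  | insert m s hm ih =>
    by_cases hs : ∀ x, (∀ i ∈ s, A i x ≤ 0) → c x ≤ 0
    · obtain ⟨u, hu, rfl⟩ := ih A c hs
      refine ⟨Function.update u m 0, le_update_iff.2 ⟨le_rfl, fun i _ => hu i⟩, ?_⟩
      rw [sum_insert_update_smul hm, zero_smul, zero_add]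
    · push Not at hs
      obtain ⟨v, hv, hcv⟩ := hs
      have hmv : 0 < A m v := by
        by_contra! hmv
        exact (h v (Finset.forall_mem_insert _ _ _ |>.2 ⟨hmv, hv⟩)).not_gt hcv
      -- The projection along `v` onto the kernel of `A m` eliminates the constraint `m`.
      let P : E →ₗ[𝕜] E := LinearMap.id - ((A m v)⁻¹ • A m).smulRight v
      have hP : ∀ (f : Module.Dual 𝕜 E) x, f (P x) = f x - f v * (A m v)⁻¹ * A m x := by
        intro f x
        simp only [P, map_sub, map_smul, LinearMap.sub_apply, LinearMap.id_apply,
          LinearMap.smulRight_apply, LinearMap.smul_apply, smul_eq_mul]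
        ring
      obtain ⟨u, hu, hcu⟩ := ih (fun i => A i ∘ₗ P) (c ∘ₗ P) fun x hx =>
        h (P x) (Finset.forall_mem_insert _ _ _ |>.2 ⟨by simp [hP, hmv.ne'], hx⟩)
      have ht : 0 ≤ (c v - ∑ i ∈ s, u i * A i v) * (A m v)⁻¹ := by
        refine mul_nonneg (sub_nonneg.2 (le_trans ?_ hcv.le)) (inv_nonneg.2 hmv.le)
        exact Finset.sum_nonpos fun i hi => mul_nonpos_of_nonneg_of_nonpos (hu i) (hv i hi)
      refine ⟨Function.update u m _, le_update_iff.2 ⟨ht, fun i _ => hu i⟩, ?_⟩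
      rw [sum_insert_update_smul hm]
      ext x
      have hx := LinearMap.congr_fun hcu x
      simp only [LinearMap.comp_apply, LinearMap.sum_apply, LinearMap.smul_apply, smul_eq_mul,
        hP, mul_sub, Finset.sum_sub_distrib, ← mul_assoc, ← Finset.sum_mul] at hx
      simp only [LinearMap.add_apply, LinearMap.sum_apply, LinearMap.smul_apply, smul_eq_mul]
      linear_combination hx

theorem exists_dual_solution [Fintype ι] {A : ι → Module.Dual 𝕜 E} {β : ι → 𝕜}
    {c : Module.Dual 𝕜 E} {r : 𝕜} {x₀ : E} (h₀ : ∀ i, A i x₀ ≤ β i)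
    (h : ∀ x, (∀ i, A i x ≤ β i) → c x ≤ r) :
    ∃ u : ι → 𝕜, 0 ≤ u ∧ c = ∑ i, u i • A i ∧ ∑ i, u i * β i ≤ r := by
  have recession : ∀ x, (∀ i, A i x ≤ 0) → c x ≤ 0 := by
    intro x hx
    by_contra! hcx
    have ht : 0 ≤ (r - c x₀ + 1) / c x := by have := h x₀ h₀; positivity
    have := h (x₀ + ((r - c x₀ + 1) / c x) • x) fun i => by
      simpa using add_le_add (h₀ i) (mul_nonpos_of_nonneg_of_nonpos ht (hx i))
    simp only [map_add, map_smul, smul_eq_mul, div_mul_cancel₀ _ hcx.ne'] at this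
    linarith
  -- The system is homogenized: `none` is the constraint `0 ≤ τ`, the others are `A i x ≤ β i * τ`.
  obtain ⟨u, hu, hc⟩ := exists_nonneg_eq_sum_smul_of_forall_nonpos (E := E × 𝕜)
    (fun i : Option ι => i.elim (-LinearMap.snd 𝕜 E 𝕜)
      fun i => (A i).coprod (-β i • LinearMap.id))
    (c.coprod (-r • LinearMap.id)) Finset.univ <| by
      rintro ⟨x, τ⟩ hx
      have hA : ∀ i, A i x ≤ β i * τ := fun i => by simpa using hx (some i) (Finset.mem_univ _)
      obtain rfl | hτ : 0 = τ ∨ 0 < τ := by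
        simpa [← le_iff_eq_or_lt] using hx none (Finset.mem_univ _)
      · simpa using recession x (by simpa using hA)
      · have := h (τ⁻¹ • x) fun i => by
          simpa [inv_mul_le_iff₀ hτ, mul_comm τ] using hA i
        rw [map_smul, smul_eq_mul, inv_mul_le_iff₀ hτ] at this
        simpa [mul_comm] using this
  refine ⟨fun i => u (some i), fun i => hu _, LinearMap.ext fun x => ?_, ?_⟩
  · simpa [Fintype.sum_option] using LinearMap.congr_fun hc (x, 0)
  · have hr : r = u none + ∑ i, u (some i) * β i := by
      simpa [Fintype.sum_option, add_comm] using congrArg Neg.neg (LinearMap.congr_fun hc (0, 1))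
    exact hr ▸ le_add_of_nonneg_left (hu none)

end LinearProgramming

section EdgeVectors

variable {V : Type*} {H : SimpleGraph V} {b : V → ℕ} {w x : Sym2 V → ℝ} {y : V → ℝ}

/-- The edge vector with value `y i + y j` on the edge `ij`; a fractional `w`-cover is a vector
`y ≥ 0` with `w ≤ endSum y` on the edges. -/
def endSum (y : V → ℝ) : Sym2 V → ℝ :=
  Sym2.lift ⟨fun i j => y i + y j, fun _ _ => add_comm _ _⟩

@[simp]
theorem endSum_mk (y : V → ℝ) (i j : V) : endSum y s(i, j) = y i + y j := rfl

theorem IsFractionalCover.le_endSum (hy : IsFractionalCover H w y) {e : Sym2 V}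
    (he : e ∈ H.edgeSet) : w e ≤ endSum y e := by
  induction e with
  | _ i j => exact hy.1 i j he

variable [Fintype V]

open scoped Classical in
/-- The weight as a linear functional of the edge vector. -/
noncomputable def weightFunctional (H : SimpleGraph V) (w : Sym2 V → ℝ) :
    Module.Dual ℝ (Sym2 V → ℝ) :=
  ∑ e ∈ H.edgeFinset, w e • LinearMap.proj e

open scoped Classical in
/-- The load of a vertex as a linear functional of the edge vector. -/
noncomputable def loadFunctional (H : SimpleGraph V) (v : V) : Module.Dual ℝ (Sym2 V → ℝ) :=
  ∑ e ∈ H.edgeFinset with v ∈ e, LinearMap.proj e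

@[simp]
theorem weightFunctional_apply (H : SimpleGraph V) (w x : Sym2 V → ℝ) :
    weightFunctional H w x = weight H w x := by
  simp [weightFunctional, weight]

@[simp]
theorem loadFunctional_apply (H : SimpleGraph V) (v : V) (x : Sym2 V → ℝ) :
    loadFunctional H v x = load H x v := by
  simp [loadFunctional, load]

theorem load_add (H : SimpleGraph V) (x d : Sym2 V → ℝ) (v : V) :
    load H (x + d) v = load H x v + load H d v := by
  simp only [← loadFunctional_apply, map_add]

theorem weight_single [DecidableEq V] (w : Sym2 V → ℝ) {e : Sym2 V} (he : e ∈ H.edgeSet) :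
    weight H w (Pi.single e 1) = w e := by
  classical
  rw [weight, Finset.sum_eq_single_of_mem e (by simpa using he) fun e' _ h => by simp [h]]
  simp

open scoped Classical in
theorem sum_ite_mem_eq_endSum (y : V → ℝ) {e : Sym2 V} (he : ¬ e.IsDiag) :
    ∑ i, (if i ∈ e then y i else 0) = endSum y e := by
  induction e with
  | _ u v =>
    rw [← Finset.sum_filter, show ({i | i ∈ s(u, v)} : Finset V) = {u, v} by ext; simp,
      Finset.sum_pair (by simpa using he), endSum_mk]

theorem sum_mul_load (H : SimpleGraph V) (x : Sym2 V → ℝ) (y : V → ℝ) :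
    ∑ v, y v * load H x v = weight H (endSum y) x := by
  classical
  simp only [load, weight, Finset.sum_filter, Finset.mul_sum]
  rw [Finset.sum_comm]
  refine Finset.sum_congr rfl fun e he => ?_
  rw [← sum_ite_mem_eq_endSum y (H.not_isDiag_of_mem_edgeFinset he), Finset.sum_mul]
  exact Finset.sum_congr rfl fun v _ => by split_ifs <;> simp

theorem weight_mono {w' : Sym2 V → ℝ} (hx : ∀ e ∈ H.edgeSet, 0 ≤ x e)
    (hw : ∀ e ∈ H.edgeSet, w e ≤ w' e) : weight H w x ≤ weight H w' x := by
  classical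
  refine Finset.sum_le_sum fun e he => ?_
  rw [SimpleGraph.mem_edgeFinset] at he
  exact mul_le_mul_of_nonneg_right (hw e he) (hx e he)

theorem weight_endSum_le_sum (hx : IsFractionalBMatching H b x) (hy : ∀ i, 0 ≤ y i) :
    weight H (endSum y) x ≤ ∑ i, (b i : ℝ) * y i := by
  rw [← sum_mul_load]
  refine Finset.sum_le_sum fun v _ => ?_
  rw [mul_comm (b v : ℝ)]
  exact mul_le_mul_of_nonneg_left (hx.1 v) (hy v)

theorem weight_le_sum (hx : IsFractionalBMatching H b x) (hy : IsFractionalCover H w y) :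
    weight H w x ≤ ∑ i, (b i : ℝ) * y i :=
  (weight_mono hx.2 fun _ => hy.le_endSum).trans (weight_endSum_le_sum hx hy.2)

theorem eq_endSum_of_pos (hx : IsFractionalBMatching H b x) (hy : IsFractionalCover H w y)
    (hxy : weight H w x = ∑ i, (b i : ℝ) * y i) {e : Sym2 V} (he : e ∈ H.edgeSet)
    (hpos : 0 < x e) : w e = endSum y e := by
  classical
  have heq : weight H w x = weight H (endSum y) x :=
    (weight_mono hx.2 fun _ => hy.le_endSum).antisymm (hxy ▸ weight_endSum_le_sum hx hy.2)
  have := (Finset.sum_eq_sum_iff_of_le fun e he => by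
    rw [SimpleGraph.mem_edgeFinset] at he
    exact mul_le_mul_of_nonneg_right (hy.le_endSum he) (hx.2 e he)).1 heq e (by simpa using he)
  exact mul_right_cancel₀ hpos.ne' this

theorem IsMaxFractionalBMatching.exists_cover_le (hx : IsMaxFractionalBMatching H b w x) :
    ∃ y, IsFractionalCover H w y ∧ ∑ i, (b i : ℝ) * y i ≤ weight H w x := by
  classical
  have feasible_iff : ∀ d, IsFractionalBMatching H b d ↔ ∀ i : V ⊕ H.edgeSet,
      Sum.elim (loadFunctional H) (fun e : H.edgeSet => -LinearMap.proj e.1) i d ≤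
        Sum.elim (fun v => (b v : ℝ)) 0 i := by
    simp [IsFractionalBMatching]
  obtain ⟨u, hu, hc, hle⟩ := exists_dual_solution (c := weightFunctional H w)
    ((feasible_iff x).1 hx.1) fun d hd => by simpa using hx.2 d ((feasible_iff d).2 hd)
  have hw : ∀ d, weight H w d = weight H (endSum fun v => u (.inl v)) d -
      ∑ e : H.edgeSet, u (.inr e) * d e := fun d => by
    simpa [Fintype.sum_sum_type, sum_mul_load, sub_eq_add_neg] using LinearMap.congr_fun hc d
  refine ⟨fun v => u (.inl v), ⟨fun i j hij => ?_, fun i => hu _⟩, ?_⟩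
  · have he : s(i, j) ∈ H.edgeSet := hij
    have := hw (Pi.single s(i, j) 1)
    rw [weight_single w he, weight_single _ he, endSum_mk] at this
    rw [this]
    have single_nonneg : (0 : Sym2 V → ℝ) ≤ Pi.single s(i, j) 1 := Pi.single_nonneg.2 zero_le_one
    exact sub_le_self _ (Finset.sum_nonneg fun e _ => mul_nonneg (hu _) (single_nonneg e))
  · simpa [Fintype.sum_sum_type, mul_comm] using hle

theorem IsMaxFractionalBMatching.exists_isMinFractionalCover
    (hx : IsMaxFractionalBMatching H b w x) : ∃ y, IsMinFractionalCover H b w y := by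
  obtain ⟨y, hy, hle⟩ := hx.exists_cover_le
  exact ⟨y, hy, fun y' hy' => hle.trans (weight_le_sum hx.1 hy')⟩

theorem IsMinFractionalCover.weight_eq (hx : IsMaxFractionalBMatching H b w x)
    (hy : IsMinFractionalCover H b w y) : weight H w x = ∑ i, (b i : ℝ) * y i := by
  obtain ⟨y', hy', hle⟩ := hx.exists_cover_le
  exact (weight_le_sum hx.1 hy.1).antisymm ((hy.2 y' hy').trans hle)

end EdgeVectors

section ExtremePoints

open Filter Topology

variable {E : Type*} [AddCommGroup E] [Module ℝ E]

theorem exists_mem_extremePoints_forall_le [TopologicalSpace E] [T2Space E]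
    [IsTopologicalAddGroup E] [ContinuousSMul ℝ E] [LocallyConvexSpace ℝ E] {s : Set E}
    (hs : IsCompact s) (hne : s.Nonempty) (l : StrongDual ℝ E) :
    ∃ x ∈ s.extremePoints ℝ, ∀ z ∈ s, l z ≤ l x := by
  obtain ⟨m, hm, hmax⟩ := hs.exists_isMaxOn hne l.continuous.continuousOn
  have hexp : IsExposed ℝ s (l.toExposed s) := ContinuousLinearMap.toExposed.isExposed
  obtain ⟨x, hx⟩ := (hexp.isCompact hs).extremePoints_nonempty ⟨m, hm, hmax⟩
  exact ⟨x, hexp.isExtreme.extremePoints_subset_extremePoints hx, hx.1.2⟩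

theorem eq_zero_of_eventually_add_smul_mem {s : Set E} {x d : E} (hx : x ∈ s.extremePoints ℝ)
    (h : ∀ᶠ t in 𝓝 (0 : ℝ), x + t • d ∈ s) : d = 0 := by
  have hneg : ∀ᶠ t in 𝓝 (0 : ℝ), x + (-t) • d ∈ s :=
    (continuous_neg.tendsto' (0 : ℝ) 0 neg_zero).eventually h
  obtain ⟨t, ⟨ht, htn⟩, ht0⟩ :=
    ((h.and hneg).filter_mono nhdsWithin_le_nhds |>.and self_mem_nhdsWithin :
      ∀ᶠ t in 𝓝[≠] (0 : ℝ), _).exists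
  have hmid : x ∈ openSegment ℝ (x + t • d) (x + (-t) • d) :=
    ⟨1 / 2, 1 / 2, by norm_num, by norm_num, by norm_num, by module⟩
  have := ((mem_extremePoints.1 hx).2 _ ht _ htn hmid).1
  simpa [show t ≠ 0 from ht0] using this

theorem eventually_add_mul_le {a β c : ℝ} (h : a ≤ β) (hc : a = β → c = 0) :
    ∀ᶠ t in 𝓝 (0 : ℝ), a + t * c ≤ β := by
  rcases h.eq_or_lt with rfl | h
  · simp [hc rfl]
  · have hcont : Tendsto (fun t : ℝ => a + t * c) (𝓝 0) (𝓝 a) :=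
      Continuous.tendsto' (by fun_prop) _ _ (by simp)
    exact (hcont.eventually_lt_const h).mono fun t => le_of_lt

end ExtremePoints

section Polytope

variable {V : Type*} [Fintype V] {H : SimpleGraph V} {b : V → ℕ} {w x : Sym2 V → ℝ}

/-- The polytope of the fractional `b`-matchings. An edge vector also has values outside the edge
set, which are required to be `0` here in order to make the set bounded. -/
def matchingPolytope (H : SimpleGraph V) (b : V → ℕ) : Set (Sym2 V → ℝ) :=
  {x | IsFractionalBMatching H b x ∧ ∀ e ∉ H.edgeSet, x e = 0}

theorem load_congr {x' : Sym2 V → ℝ} (h : ∀ e ∈ H.edgeSet, x e = x' e) (v : V) :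
    load H x v = load H x' v := by
  classical
  exact Finset.sum_congr rfl fun e he => h e (by simpa using (Finset.mem_filter.1 he).1)

theorem weight_congr {w' x' : Sym2 V → ℝ} (h : ∀ e ∈ H.edgeSet, w e * x e = w' e * x' e) :
    weight H w x = weight H w' x' := by
  classical
  exact Finset.sum_congr rfl fun e he => h e (by simpa using he)

theorem IsFractionalBMatching.congr {x' : Sym2 V → ℝ} (hx : IsFractionalBMatching H b x)
    (h : ∀ e ∈ H.edgeSet, x e = x' e) : IsFractionalBMatching H b x' :=
  ⟨fun v => load_congr h v ▸ hx.1 v, fun e he => h e he ▸ hx.2 e he⟩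

theorem le_load (hx : ∀ e ∈ H.edgeSet, 0 ≤ x e) {e : Sym2 V} (he : e ∈ H.edgeSet) {v : V}
    (hv : v ∈ e) : x e ≤ load H x v := by
  classical
  refine Finset.single_le_sum (fun e' he' => ?_) (by simp [he, hv])
  exact hx e' (by simpa using (Finset.mem_filter.1 he').1)

theorem matchingPolytope_subset_Icc (H : SimpleGraph V) (b : V → ℕ) :
    matchingPolytope H b ⊆ Set.Icc 0 fun _ => ∑ v, (b v : ℝ) := by
  rintro x ⟨hx, hx0⟩
  refine ⟨fun e => ?_, fun e => ?_⟩ <;> by_cases he : e ∈ H.edgeSet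
  · exact hx.2 e he
  · exact (hx0 e he).ge
  · have hle : x e ≤ b e.out.1 := (le_load hx.2 he e.out_fst_mem).trans (hx.1 _)
    exact hle.trans (Finset.single_le_sum (f := fun v => (b v : ℝ))
      (fun _ _ => Nat.cast_nonneg _) (Finset.mem_univ _))
  · exact (hx0 e he).trans_le (Finset.sum_nonneg fun _ _ => Nat.cast_nonneg _)

theorem isClosed_matchingPolytope (H : SimpleGraph V) (b : V → ℕ) :
    IsClosed (matchingPolytope H b) := by
  simp only [matchingPolytope, IsFractionalBMatching, Set.ofPred_and, Set.ofPred_forall,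
    ← loadFunctional_apply]
  refine ((isClosed_iInter fun v => isClosed_le ?_ continuous_const).inter
    (isClosed_biInter fun e _ => isClosed_le continuous_const (continuous_apply e))).inter
    (isClosed_biInter fun e _ => isClosed_eq (continuous_apply e) continuous_const)
  exact (loadFunctional H v).continuous_of_finiteDimensional

theorem isCompact_matchingPolytope (H : SimpleGraph V) (b : V → ℕ) :
    IsCompact (matchingPolytope H b) :=
  isCompact_Icc.of_isClosed_subset (isClosed_matchingPolytope H b) (matchingPolytope_subset_Icc H b)

theorem exists_mem_extremePoints_isMax (H : SimpleGraph V) (b : V → ℕ) (w : Sym2 V → ℝ) :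
    ∃ x ∈ (matchingPolytope H b).extremePoints ℝ, IsMaxFractionalBMatching H b w x := by
  classical
  obtain ⟨x, hx, hmax⟩ := exists_mem_extremePoints_forall_le (isCompact_matchingPolytope H b)
    ⟨0, ⟨fun v => by simp [load], fun _ _ => le_rfl⟩, fun _ _ => rfl⟩
    (weightFunctional H w).toContinuousLinearMap
  refine ⟨x, hx, hx.1.1, fun x' hx' => ?_⟩
  have heq : ∀ e ∈ H.edgeSet, x' e = H.edgeSet.indicator x' e := fun e he => by simp [he]
  calc weight H w x' = weight H w (H.edgeSet.indicator x') :=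
        weight_congr fun e he => by rw [← heq e he]
    _ ≤ weight H w x := by
        simpa using hmax _ ⟨hx'.congr heq, fun e he => Set.indicator_of_notMem he _⟩

theorem eventually_add_smul_mem_matchingPolytope {d : Sym2 V → ℝ} (hx : x ∈ matchingPolytope H b)
    (hd : ∀ e, x e = 0 → d e = 0) (hload : ∀ v, load H x v = b v → load H d v = 0) :
    ∀ᶠ t in nhds (0 : ℝ), x + t • d ∈ matchingPolytope H b := by
  have edge : ∀ᶠ t in nhds (0 : ℝ), ∀ e, e ∈ H.edgeSet → -x e + t * -d e ≤ 0 := by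
    refine Filter.eventually_all.2 fun e => Filter.eventually_imp_distrib_left.2 fun he => ?_
    exact eventually_add_mul_le (neg_nonpos.2 (hx.1.2 e he)) fun h => by
      simp [hd e (by simpa using h)]
  have vertex : ∀ᶠ t in nhds (0 : ℝ), ∀ v, load H x v + t * load H d v ≤ b v :=
    Filter.eventually_all.2 fun v => eventually_add_mul_le (hx.1.1 v) (hload v)
  filter_upwards [edge, vertex] with t he hv
  refine ⟨⟨fun v => ?_, fun e h => ?_⟩, fun e h => ?_⟩
  · simpa [← loadFunctional_apply] using hv v
  · have := he e h
    simp only [Pi.add_apply, Pi.smul_apply, smul_eq_mul]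
    linarith
  · simp [hx.2 e h, hd e (hx.2 e h)]

end Polytope

section NonIntegralEdges

variable {V : Type*} {H K : SimpleGraph V} {x d : Sym2 V → ℝ}

theorem isInteger_iff_mem_range {r : ℝ} : IsInteger r ↔ r ∈ (Int.castRingHom ℝ).range := by
  simp [IsInteger, eq_comm]

theorem isInteger_iff_fract_eq_zero {r : ℝ} : IsInteger r ↔ Int.fract r = 0 := by
  simp [IsInteger, Int.fract_eq_zero_iff, eq_comm]

theorem mem_edgeSet_nonIntegralGraph {e : Sym2 V} :
    e ∈ (nonIntegralGraph H x).edgeSet ↔ e ∈ H.edgeSet ∧ ¬ IsInteger (x e) := by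
  induction e with
  | _ u v => rfl

theorem nonIntegralGraph_le (H : SimpleGraph V) (x : Sym2 V → ℝ) : nonIntegralGraph H x ≤ H :=
  fun _ _ h => h.1

variable [Fintype V]

open scoped Classical in
theorem load_eq_sum_incidenceFinset (H : SimpleGraph V) (x : Sym2 V → ℝ) (v : V) :
    load H x v = ∑ e ∈ H.incidenceFinset v, x e := by
  rw [load, SimpleGraph.incidenceFinset_eq_filter]

theorem load_eq_load_of_le (h : K ≤ H) (hd : ∀ e ∈ H.edgeSet, e ∉ K.edgeSet → d e = 0) (v : V) :
    load H d v = load K d v := by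
  classical
  symm
  refine Finset.sum_subset
    (Finset.filter_subset_filter _ (SimpleGraph.edgeFinset_subset_edgeFinset.2 h)) ?_
  intro e he heK
  simp only [Finset.mem_filter, SimpleGraph.mem_edgeFinset, not_and'] at he heK
  exact hd e he.1 (heK he.2)

open scoped Classical in
theorem load_const (K : SimpleGraph V) (c : ℝ) (v : V) :
    load K (fun _ => c) v = K.degree v * c := by
  rw [load_eq_sum_incidenceFinset, Finset.sum_const, SimpleGraph.card_incidenceFinset_eq_degree,
    nsmul_eq_mul]

theorem isInteger_load (hx : ∀ e ∈ H.edgeSet, IsInteger (x e)) (v : V) :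
    IsInteger (load H x v) := by
  classical
  refine isInteger_iff_mem_range.2 (sum_mem fun e he => isInteger_iff_mem_range.1 (hx e ?_))
  simpa using (Finset.mem_filter.1 he).1

theorem load_fract_eq (H : SimpleGraph V) (x : Sym2 V → ℝ) (v : V) :
    load H (Int.fract ∘ x) v = load (nonIntegralGraph H x) (Int.fract ∘ x) v :=
  load_eq_load_of_le (nonIntegralGraph_le H x) (fun e he hK => isInteger_iff_fract_eq_zero.1 <| by
    simpa [mem_edgeSet_nonIntegralGraph, he] using hK) v

theorem isInteger_load_fract {v : V} (hv : IsInteger (load H x v)) :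
    IsInteger (load (nonIntegralGraph H x) (Int.fract ∘ x) v) := by
  have hfloor : IsInteger (load H (fun e => (⌊x e⌋ : ℝ)) v) :=
    isInteger_load (fun _ _ => ⟨_, rfl⟩) v
  have hsub : load H (Int.fract ∘ x) v = load H x v - load H (fun e => (⌊x e⌋ : ℝ)) v := by
    simp only [← loadFunctional_apply, ← map_sub]
    rfl
  rw [← load_fract_eq, hsub, isInteger_iff_mem_range]
  exact sub_mem (isInteger_iff_mem_range.1 hv) (isInteger_iff_mem_range.1 hfloor)

open scoped Classical in
theorem load_fract_mem_Ioo {v : V} (hv : (nonIntegralGraph H x).degree v ≠ 0) :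
    load (nonIntegralGraph H x) (Int.fract ∘ x) v ∈
      Set.Ioo 0 ((nonIntegralGraph H x).degree v : ℝ) := by
  rw [← SimpleGraph.card_incidenceFinset_eq_degree, Finset.card_ne_zero] at hv
  rw [load_eq_sum_incidenceFinset, ← SimpleGraph.card_incidenceFinset_eq_degree, Finset.cast_card]
  refine ⟨Finset.sum_pos (fun e he => ?_) hv,
    Finset.sum_lt_sum_of_nonempty hv fun e _ => Int.fract_lt_one _⟩
  have he' := SimpleGraph.mem_edgeFinset.1 (SimpleGraph.incidenceFinset_subset _ _ he)
  exact (Int.fract_nonneg _).lt_of_ne'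
    (mt isInteger_iff_fract_eq_zero.2 (mem_edgeSet_nonIntegralGraph.1 he').2)

open scoped Classical in
theorem two_le_degree_of_isInteger_load {v : V} (hv : IsInteger (load H x v))
    (hdeg : (nonIntegralGraph H x).degree v ≠ 0) : 2 ≤ (nonIntegralGraph H x).degree v := by
  obtain ⟨n, hn⟩ := isInteger_load_fract hv
  have hlt := load_fract_mem_Ioo hdeg
  rw [hn, Set.mem_Ioo] at hlt
  norm_cast at hlt
  omega

open scoped Classical in
theorem load_fract_of_degree_eq_two {v : V} (hv : IsInteger (load H x v))
    (hdeg : (nonIntegralGraph H x).degree v = 2) :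
    load (nonIntegralGraph H x) (Int.fract ∘ x) v = 1 := by
  obtain ⟨n, hn⟩ := isInteger_load_fract hv
  have hlt := load_fract_mem_Ioo (hdeg ▸ two_ne_zero)
  rw [hn, hdeg, Set.mem_Ioo] at hlt
  norm_cast at hlt
  rw [hn]
  exact_mod_cast (show n = 1 by omega)

open scoped Classical in
theorem load_eq_zero_of_degree_eq_zero {v : V} (hv : K.degree v = 0) (d : Sym2 V → ℝ) :
    load K d v = 0 := by
  rw [← SimpleGraph.card_incidenceFinset_eq_degree, Finset.card_eq_zero] at hv
  rw [load_eq_sum_incidenceFinset, hv, Finset.sum_empty]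

open scoped Classical in
theorem exists_ne_zero_load_eq_zero {T : Finset V} (h : T.card < K.edgeFinset.card) :
    ∃ d : Sym2 V → ℝ, d ≠ 0 ∧ (∀ e ∉ K.edgeSet, d e = 0) ∧ ∀ v ∈ T, load K d v = 0 := by
  let extend : (K.edgeSet → ℝ) →ₗ[ℝ] (Sym2 V → ℝ) :=
    Function.ExtendByZero.linearMap ℝ Subtype.val
  have hrank : Module.finrank ℝ (T → ℝ) < Module.finrank ℝ (K.edgeSet → ℝ) := by
    rw [Module.finrank_fintype_fun_eq_card, Module.finrank_fintype_fun_eq_card, Fintype.card_coe,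
      ← SimpleGraph.edgeFinset_card]
    convert h
  obtain ⟨g, hg, hg0⟩ := Submodule.exists_mem_ne_zero_of_ne_bot <|
    LinearMap.ker_ne_bot_of_finrank_lt
      (f := LinearMap.pi (fun v : T => loadFunctional K v) ∘ₗ extend) hrank
  have hgv : ∀ e, extend g e.1 = g e := fun e => Subtype.val_injective.extend_apply g 0 e
  refine ⟨extend g, fun h0 => hg0 (funext fun e => ?_), fun e he => ?_, fun v hv => ?_⟩
  · rw [← hgv, h0]; rfl
  · exact Function.extend_apply' _ _ _ (by simpa using he)
  · simpa using congrFun hg ⟨v, hv⟩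

open scoped Classical in
theorem degree_eq_two_of_card_edgeFinset_le {T : Finset V} (hT : ∀ v ∈ T, 2 ≤ K.degree v)
    (hcard : K.edgeFinset.card ≤ T.card) : ∀ v ∈ T, K.degree v = 2 := by
  have hsum : ∑ v ∈ T, K.degree v ≤ ∑ v ∈ T, 2 :=
    calc ∑ v ∈ T, K.degree v ≤ ∑ v, K.degree v := Finset.sum_le_sum_of_subset T.subset_univ
      _ = 2 * K.edgeFinset.card := K.sum_degrees_eq_twice_card_edges
      _ ≤ ∑ v ∈ T, 2 := by rw [Finset.sum_const, smul_eq_mul]; omega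
  exact fun v hv =>
    ((Finset.sum_eq_sum_iff_of_le hT).1 ((Finset.sum_le_sum hT).antisymm hsum) v hv).symm

end NonIntegralEdges

section HalfIntegralOptimum

variable {V : Type*} [Fintype V] {H : SimpleGraph V} {b : V → ℕ} {w x d : Sym2 V → ℝ}

theorem eq_zero_of_mem_extremePoints_matchingPolytope
    (hx : x ∈ (matchingPolytope H b).extremePoints ℝ)
    (hd : ∀ e ∉ (nonIntegralGraph H x).edgeSet, d e = 0)
    (hload : ∀ v, load H x v = b v → load (nonIntegralGraph H x) d v = 0) : d = 0 := by
  refine eq_zero_of_eventually_add_smul_mem hx <|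
    eventually_add_smul_mem_matchingPolytope hx.1 (fun e he => hd e fun hK => ?_) fun v hv => ?_
  · exact (mem_edgeSet_nonIntegralGraph.1 hK).2 ⟨0, by simpa using he⟩
  · rw [load_eq_load_of_le (nonIntegralGraph_le H x) fun e _ => hd e, hload v hv]

open scoped Classical in
theorem degree_eq_two_of_mem_extremePoints (hx : x ∈ (matchingPolytope H b).extremePoints ℝ)
    {v : V} (hv : load H x v = b v) (hdeg : (nonIntegralGraph H x).degree v ≠ 0) :
    (nonIntegralGraph H x).degree v = 2 := by
  let K := nonIntegralGraph H x
  let T : Finset V := {v | load H x v = b v ∧ K.degree v ≠ 0}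
  refine degree_eq_two_of_card_edgeFinset_le (T := T) (fun v hv => ?_) ?_ v
    (by simp [T, K, hv, hdeg])
  · obtain ⟨hv, hdeg⟩ : load H x v = b v ∧ K.degree v ≠ 0 := by simpa [T] using hv
    exact two_le_degree_of_isInteger_load ⟨b v, by simp [hv]⟩ hdeg
  · by_contra! hlt
    obtain ⟨d, hd0, hd, hdT⟩ := exists_ne_zero_load_eq_zero hlt
    refine hd0 (eq_zero_of_mem_extremePoints_matchingPolytope hx hd fun v hv => ?_)
    by_cases hdeg : K.degree v = 0
    · exact load_eq_zero_of_degree_eq_zero hdeg d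
    · exact hdT v (by simp [T, hv, hdeg])

theorem isHalfIntegral_of_mem_extremePoints (hx : x ∈ (matchingPolytope H b).extremePoints ℝ) :
    IsHalfIntegral H x := by
  classical
  let K := nonIntegralGraph H x
  let c : Sym2 V → ℝ := fun _ => 1 / 2
  have hzero : K.edgeSet.indicator (Int.fract ∘ x - c) = 0 := by
    refine eq_zero_of_mem_extremePoints_matchingPolytope hx
      (fun e he => Set.indicator_of_notMem he _) fun v hv => ?_
    have hload : load K (K.edgeSet.indicator (Int.fract ∘ x - c)) v =
        load K (Int.fract ∘ x) v - K.degree v * (1 / 2) := by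
      rw [load_congr fun e he => Set.indicator_of_mem he _, ← load_const]
      simp only [← loadFunctional_apply, map_sub, c]
    by_cases hdeg : K.degree v = 0
    · exact load_eq_zero_of_degree_eq_zero hdeg _
    · have hdeg2 := degree_eq_two_of_mem_extremePoints hx hv hdeg
      rw [hload, load_fract_of_degree_eq_two ⟨b v, by simp [hv]⟩ hdeg2, hdeg2]
      norm_num
  intro e he
  by_cases hi : IsInteger (x e)
  · obtain ⟨n, hn⟩ := hi
    exact ⟨2 * n, by simp [hn]⟩
  · have hfract : Int.fract (x e) = 1 / 2 := by
      simpa [K, c, mem_edgeSet_nonIntegralGraph, he, hi, sub_eq_zero] using congrFun hzero e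
    exact ⟨2 * ⌊x e⌋ + 1, by push_cast; linarith [Int.floor_add_fract (x e)]⟩

theorem exists_isMax_isHalfIntegral (H : SimpleGraph V) (b : V → ℕ) (w : Sym2 V → ℝ) :
    ∃ x, IsMaxFractionalBMatching H b w x ∧ IsHalfIntegral H x := by
  obtain ⟨x, hx, hmax⟩ := exists_mem_extremePoints_isMax H b w
  exact ⟨x, hmax, isHalfIntegral_of_mem_extremePoints hx⟩

end HalfIntegralOptimum

section HalfIntegers

variable {r s : ℝ}

theorem exists_eq_add_half (h2 : IsInteger (2 * r)) (h : ¬ IsInteger r) :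
    ∃ n : ℤ, r = n + 1 / 2 := by
  obtain ⟨m, hm⟩ := h2
  rcases m.even_or_odd' with ⟨n, rfl | rfl⟩ <;> push_cast at hm
  · exact absurd ⟨n, by linarith⟩ h
  · exact ⟨n, by linarith⟩

theorem half_le_of_not_isInteger (h2 : IsInteger (2 * r)) (h : ¬ IsInteger r) (h0 : 0 ≤ r) :
    1 / 2 ≤ r := by
  obtain ⟨n, rfl⟩ := exists_eq_add_half h2 h
  have hn : (-1 : ℝ) < n := by linarith
  have : (0 : ℝ) ≤ n := by exact_mod_cast (show 0 ≤ n by exact_mod_cast hn)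
  linarith

theorem isInteger_add_of_abs_eq_half (h2 : IsInteger (2 * r)) (h : ¬ IsInteger r)
    (hs : |s| = 1 / 2) : IsInteger (r + s) := by
  obtain ⟨n, rfl⟩ := exists_eq_add_half h2 h
  rcases eq_or_eq_neg_of_abs_eq hs with rfl | rfl
  · exact ⟨n + 1, by push_cast; ring⟩
  · exact ⟨n, by ring⟩

end HalfIntegers

section AlternatingVector

variable {V : Type*} {H K : SimpleGraph V} {u v : V}

/-- The edge vector with the values `-1/2, +1/2, -1/2, …` along a list of edges without
repetition and `0` elsewhere: the change made by `alternate`. -/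
noncomputable def alternatingVector (T : List (Sym2 V)) : Sym2 V → ℝ := alternate 0 T

theorem alternate_eq_add (x : Sym2 V → ℝ) (T : List (Sym2 V)) :
    alternate x T = x + alternatingVector T := by
  ext e
  simp only [alternatingVector, alternate, Pi.add_apply, Pi.zero_apply]
  split_ifs <;> ring

theorem alternatingVector_of_notMem {T : List (Sym2 V)} {e : Sym2 V} (he : e ∉ T) :
    alternatingVector T e = 0 := by
  simp [alternatingVector, alternate, he]

theorem abs_alternatingVector {T : List (Sym2 V)} {e : Sym2 V} (he : e ∈ T) :
    |alternatingVector T e| = 1 / 2 := by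
  rw [alternatingVector, alternate, if_pos he]
  split_ifs <;> simp

open scoped Classical in
theorem alternatingVector_cons {T : List (Sym2 V)} {a : Sym2 V} (ha : a ∉ T) :
    alternatingVector (a :: T) = -(Pi.single a (1 / 2) + alternatingVector T) := by
  ext e
  by_cases hea : e = a
  · subst hea
    simp [alternatingVector, alternate, ha]
  · by_cases he : e ∈ T
    · rcases Nat.even_or_odd (T.idxOf e) with h | h <;>
        simp [alternatingVector, alternate, hea, he, List.idxOf_cons_ne _ (Ne.symm hea),
          Nat.even_add_one, h]
    · simp [alternatingVector, alternate, hea, he]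

variable [Fintype V]

theorem weight_endSum_alternatingVector (hle : K ≤ H) (y : V → ℝ) {p : K.Walk u v}
    (hp : p.IsTrail) :
    weight H (endSum y) (alternatingVector p.edges) = ((-1) ^ p.length * y v - y u) / 2 := by
  classical
  induction p with
  | nil => simp [weight, alternatingVector_of_notMem]
  | @cons u m v h p ih =>
    rw [SimpleGraph.Walk.isTrail_cons] at hp
    have he : s(u, m) ∈ H.edgeSet := hle h
    have hsingle : (Pi.single s(u, m) (1 / 2) : Sym2 V → ℝ) =
        (1 / 2 : ℝ) • Pi.single s(u, m) 1 := by
      rw [← Pi.single_smul', smul_eq_mul, mul_one]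
    rw [SimpleGraph.Walk.edges_cons, alternatingVector_cons hp.2, ← weightFunctional_apply, map_neg,
      map_add, hsingle, map_smul, weightFunctional_apply, weightFunctional_apply, ih hp.1,
      weight_single _ he, endSum_mk, SimpleGraph.Walk.length_cons, smul_eq_mul]
    ring

theorem load_alternatingVector [DecidableEq V] (hle : K ≤ H) {p : K.Walk u v} (hp : p.IsTrail)
    (i : V) :
    load H (alternatingVector p.edges) i =
      ((-1) ^ p.length * (Pi.single i 1 : V → ℝ) v - (Pi.single i 1 : V → ℝ) u) / 2 := by
  rw [← weight_endSum_alternatingVector hle _ hp, ← sum_mul_load]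
  simp [Pi.single_apply]

end AlternatingVector

section HalfIntegralVectors

variable {V : Type*} {H : SimpleGraph V} {b : V → ℕ} {w x d : Sym2 V → ℝ}

theorem IsHalfIntegral.add (hx : IsHalfIntegral H x) (hd : IsHalfIntegral H d) :
    IsHalfIntegral H (x + d) := fun e he => by
  rw [Pi.add_apply, mul_add, isInteger_iff_mem_range]
  exact add_mem (isInteger_iff_mem_range.1 (hx e he)) (isInteger_iff_mem_range.1 (hd e he))

theorem isHalfIntegral_alternatingVector (H : SimpleGraph V) (T : List (Sym2 V)) :
    IsHalfIntegral H (alternatingVector T) := fun e _ => by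
  by_cases he : e ∈ T
  · rcases eq_or_eq_neg_of_abs_eq (abs_alternatingVector he) with h | h
    · exact ⟨1, by rw [h]; norm_num⟩
    · exact ⟨-1, by rw [h]; norm_num⟩
  · exact ⟨0, by simp [alternatingVector_of_notMem he]⟩

theorem IsHalfIntegral.half_le (hx : IsHalfIntegral H x) (h0 : ∀ e ∈ H.edgeSet, 0 ≤ x e)
    {e : Sym2 V} (he : e ∈ (nonIntegralGraph H x).edgeSet) : 1 / 2 ≤ x e := by
  rw [mem_edgeSet_nonIntegralGraph] at he
  exact half_le_of_not_isInteger (hx e he.1) he.2 (h0 e he.1)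

theorem edgeSet_nonIntegralGraph_add_alternatingVector (hx : IsHalfIntegral H x)
    {T : List (Sym2 V)} (hT : ∀ e ∈ T, e ∈ (nonIntegralGraph H x).edgeSet) :
    (nonIntegralGraph H (x + alternatingVector T)).edgeSet =
      (nonIntegralGraph H x).edgeSet \ {e | e ∈ T} := by
  ext e
  by_cases he : e ∈ T
  · have heK := mem_edgeSet_nonIntegralGraph.1 (hT e he)
    simp [mem_edgeSet_nonIntegralGraph, he,
      isInteger_add_of_abs_eq_half (hx e heK.1) heK.2 (abs_alternatingVector he)]
  · simp [mem_edgeSet_nonIntegralGraph, he, alternatingVector_of_notMem he]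

variable [Fintype V]

theorem isFractionalBMatching_add (hd : ∀ e ∈ H.edgeSet, |d e| ≤ x e)
    (hload : ∀ v, |load H d v| ≤ b v - load H x v) : IsFractionalBMatching H b (x + d) := by
  refine ⟨fun v => ?_, fun e he => ?_⟩
  · rw [load_add]
    linarith [le_of_abs_le (hload v)]
  · rw [Pi.add_apply]
    linarith [neg_le_of_abs_le (hd e he)]

theorem IsMaxFractionalBMatching.add (hx : IsMaxFractionalBMatching H b w x)
    (hd : ∀ e ∈ H.edgeSet, |d e| ≤ x e) (hload : ∀ v, |load H d v| ≤ b v - load H x v) :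
    IsMaxFractionalBMatching H b w (x + d) := by
  have hneg := hx.2 _ (isFractionalBMatching_add (b := b) (d := -d)
    (fun e he => by simpa using hd e he) fun v => by
      simpa [← loadFunctional_apply] using hload v)
  refine ⟨isFractionalBMatching_add hd hload, fun x' hx' => (hx.2 x' hx').trans ?_⟩
  simp only [← weightFunctional_apply, map_add, map_neg] at hneg ⊢
  linarith

open scoped Classical in
theorem IsHalfIntegral.isInteger_load_sub (hx : IsHalfIntegral H x) (v : V) :
    IsInteger (load H x v - (nonIntegralGraph H x).degree v * (1 / 2)) := by
  let h : Sym2 V → ℝ := (nonIntegralGraph H x).edgeSet.indicator fun _ => 1 / 2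
  have hload : load H h v = (nonIntegralGraph H x).degree v * (1 / 2) := by
    rw [load_eq_load_of_le (nonIntegralGraph_le H x) fun e _ he => Set.indicator_of_notMem he _,
      load_congr fun e he => Set.indicator_of_mem he _, load_const]
  rw [← hload, ← loadFunctional_apply, ← loadFunctional_apply, ← map_sub, loadFunctional_apply]
  refine isInteger_load (fun e he => ?_) v
  by_cases hi : IsInteger (x e)
  · have hmem : e ∉ (nonIntegralGraph H x).edgeSet := fun h =>
      (mem_edgeSet_nonIntegralGraph.1 h).2 hi
    simpa [h, hmem] using hi
  · obtain ⟨n, hn⟩ := exists_eq_add_half (hx e he) hi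
    have hmem : e ∈ (nonIntegralGraph H x).edgeSet := mem_edgeSet_nonIntegralGraph.2 ⟨he, hi⟩
    exact ⟨n, by simp [h, hmem, hn]⟩

open scoped Classical in
theorem IsHalfIntegral.load_add_half_le (hx : IsHalfIntegral H x) {v : V} (hv : load H x v ≤ b v)
    (hodd : Odd ((nonIntegralGraph H x).degree v)) : load H x v + 1 / 2 ≤ b v := by
  obtain ⟨n, hn⟩ := hx.isInteger_load_sub v
  obtain ⟨k, hk⟩ := hodd
  rw [hk, sub_eq_iff_eq_add] at hn
  push_cast at hn
  have hlt : (n + k : ℝ) < b v := by linarith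
  have hle : (n + k + 1 : ℝ) ≤ b v := by
    exact_mod_cast (show n + k < (b v : ℤ) by exact_mod_cast hlt)
  linarith

end HalfIntegralVectors

section AlternatingTrails

variable {V : Type*} {H : SimpleGraph V} {u v : V}

/-- The trails along which a half-integral optimum may be modified: those joining two distinct
vertices of odd degree and the closed ones of even length. -/
structure IsModificationTrail (p : H.Walk u v) : Prop where
  isTrail : p.IsTrail
  ends : (u ≠ v ∧ Odd (H.neighborSet u).ncard ∧ Odd (H.neighborSet v).ncard) ∨
    (u = v ∧ Even p.length)

theorem ncard_neighborSet (H : SimpleGraph V) (v : V) [Fintype (H.neighborSet v)] :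
    (H.neighborSet v).ncard = H.degree v :=
  Set.ncard_eq_toFinset_card' _

theorem neighborSet_deleteEdges_edges (p : H.Walk u v) (t : V) :
    (H.deleteEdges {e | e ∈ p.edges}).neighborSet t =
      H.neighborSet t \ p.toSubgraph.neighborSet t := by
  ext z
  simp [← SimpleGraph.Subgraph.mem_edgeSet]

variable [Finite V]

theorem exists_reachable_odd_ncard_neighborSet (hu : Odd (H.neighborSet u).ncard) :
    ∃ v, v ≠ u ∧ Odd (H.neighborSet v).ncard ∧ H.Reachable u v := by
  classical
  cases nonempty_fintype V
  let C := H.connectedComponentMk u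
  let K := C.toSimpleGraph.spanningCoe
  have hK {v : V} (hv : v ∈ C) : K.neighborSet v = H.neighborSet v := by
    ext t
    simp only [K, SimpleGraph.mem_neighborSet, C.adj_spanningCoe_toSimpleGraph]
    exact and_iff_right hv
  obtain ⟨v, hvu, hv⟩ := K.exists_ne_odd_degree_of_exists_odd_degree u (by
    rwa [← ncard_neighborSet, hK rfl])
  rw [← ncard_neighborSet] at hv
  obtain ⟨t, ht⟩ := Set.nonempty_of_ncard_ne_zero hv.pos.ne'
  have hvC : v ∈ C := (C.adj_spanningCoe_toSimpleGraph.1 ht).1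
  exact ⟨v, hvu, hK hvC ▸ hv, (SimpleGraph.ConnectedComponent.exact hvC).symm⟩

theorem not_isBridge_of_even (hH : ∀ v, Even (H.neighborSet v).ncard) (h : H.Adj u v) :
    ¬ H.IsBridge s(u, v) := by
  let K := H.deleteEdges {s(u, v)}
  have hKu : K.neighborSet u = H.neighborSet u \ {v} := by
    ext t
    have : H.Adj u t → u ≠ t := H.ne_of_adj
    simp only [K, SimpleGraph.mem_neighborSet, SimpleGraph.deleteEdges_adj, Set.mem_sdiff,
      Set.mem_singleton_iff, Sym2.eq_iff]
    grind
  have hodd : Odd (K.neighborSet u).ncard := by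
    have hpos : 0 < (H.neighborSet u).ncard := (Set.ncard_pos (Set.toFinite _)).2 ⟨v, h⟩
    rw [hKu, Set.ncard_sdiff_singleton_of_mem (show v ∈ H.neighborSet u from h),
      ← Nat.not_even_iff_odd, Nat.even_sub hpos]
    simp [hH u]
  obtain ⟨t, htu, ht, hreach⟩ := exists_reachable_odd_ncard_neighborSet hodd
  have htv : t = v := by
    by_contra hne
    have hKt : K.neighborSet t = H.neighborSet t := by
      ext z
      simp [K, htu, hne]
    exact Nat.not_even_iff_odd.2 (hKt ▸ ht) (hH t)
  subst htv
  rwa [SimpleGraph.isBridge_iff, not_not]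

theorem exists_isCycle_of_even (hH : ∀ v, Even (H.neighborSet v).ncard)
    (hv : (H.neighborSet v).Nonempty) : ∃ p : H.Walk v v, p.IsCycle := by
  classical
  obtain ⟨u, hu⟩ := hv
  have hbridge := not_isBridge_of_even hH hu
  rw [SimpleGraph.isBridge_iff_forall_cycle_notMem hu] at hbridge
  push Not at hbridge
  obtain ⟨z, p, hp, he⟩ := hbridge
  exact ⟨p.rotate v (p.fst_mem_support_of_mem_edges he), hp.rotate _⟩

theorem even_ncard_neighborSet_deleteEdges (hH : ∀ v, Even (H.neighborSet v).ncard)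
    {p : H.Walk v v} (hp : p.IsCycle) (t : V) :
    Even ((H.deleteEdges {e | e ∈ p.edges}).neighborSet t).ncard := by
  have hsub := p.toSubgraph.neighborSet_subset t
  rw [neighborSet_deleteEdges_edges, Set.ncard_sdiff hsub, Nat.even_sub (Set.ncard_le_ncard hsub)]
  by_cases ht : t ∈ p.support
  · simp [hH t, hp.ncard_neighborSet_toSubgraph_eq_two ht]
  · have hempty : p.toSubgraph.neighborSet t = ∅ :=
      Set.eq_empty_of_forall_notMem fun _ h =>
        ht (p.mem_verts_toSubgraph.1 (p.toSubgraph.edge_vert h))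
    simp [hH t, hempty]

theorem exists_isTrail_even_length (hH : ∀ v, Even (H.neighborSet v).ncard)
    (hv : 2 < (H.neighborSet v).ncard) :
    ∃ p : H.Walk v v, p.IsTrail ∧ Even p.length ∧ ¬ p.Nil := by
  obtain ⟨p, hp⟩ := exists_isCycle_of_even hH ((Set.ncard_pos (Set.toFinite _)).1 (pos_of_gt hv))
  let K := H.deleteEdges {e | e ∈ p.edges}
  have hKH : K ≤ H := H.deleteEdges_le _
  have hKv : (K.neighborSet v).Nonempty := by
    rw [neighborSet_deleteEdges_edges]
    refine Set.sdiff_nonempty_of_ncard_lt_ncard ?_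
    rwa [hp.ncard_neighborSet_toSubgraph_eq_two p.start_mem_support]
  obtain ⟨q, hq⟩ := exists_isCycle_of_even (even_ncard_neighborSet_deleteEdges hH hp) hKv
  have hqH : (q.mapLe hKH).IsCycle := hq.mapLe hKH
  rcases Nat.even_or_odd p.length with hpe | hpo
  · exact ⟨p, hp.isTrail, hpe, hp.not_nil⟩
  rcases Nat.even_or_odd (q.mapLe hKH).length with hqe | hqo
  · exact ⟨_, hqH.isTrail, hqe, hqH.not_nil⟩
  have hdisj : p.edges.Disjoint (q.mapLe hKH).edges := fun e hep heq => by
    have heK := q.edges_subset_edgeSet (q.edges_mapLe_eq_edges hKH ▸ heq)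
    rw [SimpleGraph.edgeSet_deleteEdges] at heK
    exact heK.2 hep
  refine ⟨p.append (q.mapLe hKH), ⟨?_⟩, ?_, ?_⟩
  · rw [SimpleGraph.Walk.edges_append]
    exact hp.isTrail.edges_nodup.append hqH.isTrail.edges_nodup hdisj
  · rw [SimpleGraph.Walk.length_append]
    exact hpo.add_odd hqo
  · rw [SimpleGraph.Walk.nil_append_iff]
    exact fun h => hp.not_nil h.1

theorem isCycles_of_forall_isModificationTrail_nil
    (hH : ∀ ⦃u v : V⦄ (p : H.Walk u v), IsModificationTrail p → p.Nil) : H.IsCycles := by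
  have heven (v : V) : Even (H.neighborSet v).ncard := by
    by_contra hv
    rw [Nat.not_even_iff_odd] at hv
    obtain ⟨u, huv, hu, hreach⟩ := exists_reachable_odd_ncard_neighborSet hv
    obtain ⟨p, hp⟩ := hreach.exists_isPath
    exact huv (hH p ⟨hp.isTrail, Or.inl ⟨huv.symm, hv, hu⟩⟩).eq.symm
  intro v hv
  have hle : (H.neighborSet v).ncard ≤ 2 := by
    by_contra! hgt
    obtain ⟨p, hp, hpe, hnil⟩ := exists_isTrail_even_length heven hgt
    exact hnil (hH p ⟨hp, Or.inr ⟨rfl, hpe⟩⟩)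
  have hpos := (Set.ncard_pos (Set.toFinite _)).2 hv
  have := heven v
  grind

end AlternatingTrails

section NonIntegralCycles

variable {V : Type*} [Finite V] {G K : SimpleGraph V} {x : Sym2 V → ℝ}

theorem exists_verts_toSubgraph_eq_supp (hK : K.IsCycles) {v : V} {p : K.Walk v v}
    (hp : p.IsCycle) : ∃ c : K.ConnectedComponent, p.toSubgraph.verts = c.supp := by
  classical
  cases nonempty_fintype V
  exact p.toSubgraph_connected.exists_verts_eq_connectedComponentSupp fun _ ht z =>
    (hp.adj_toSubgraph_iff_of_isCycles hK ht z).2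

theorem toSubgraph_eq_of_isCycles (hK : K.IsCycles) {u v z : V} {p : K.Walk u u} {q : K.Walk v v}
    (hp : p.IsCycle) (hq : q.IsCycle) (hzp : z ∈ p.support) (hzq : z ∈ q.support) :
    p.toSubgraph = q.toSubgraph := by
  classical
  cases nonempty_fintype V
  obtain ⟨c, hc⟩ := exists_verts_toSubgraph_eq_supp hK hp
  obtain ⟨c', hc'⟩ := exists_verts_toSubgraph_eq_supp hK hq
  rw [← p.mem_verts_toSubgraph, hc] at hzp
  rw [← q.mem_verts_toSubgraph, hc'] at hzq
  have hverts : p.toSubgraph.verts = q.toSubgraph.verts := by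
    rw [hc, hc', SimpleGraph.ConnectedComponent.eq_of_common_vertex hzp hzq]
  refine SimpleGraph.Subgraph.ext hverts ?_
  ext s t
  by_cases hs : s ∈ p.toSubgraph.verts
  · rw [hp.adj_toSubgraph_iff_of_isCycles hK hs, hq.adj_toSubgraph_iff_of_isCycles hK (hverts ▸ hs)]
  · exact iff_of_false (fun h => hs (p.toSubgraph.edge_vert h))
      fun h => hs (hverts ▸ q.toSubgraph.edge_vert h)

theorem exists_mem_edges_of_isCycles (hK : K.IsCycles) {e : Sym2 V} (he : e ∈ K.edgeSet) :
    ∃ (v : V) (p : K.Walk v v), p.IsCycle ∧ e ∈ p.edges := by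
  induction e with
  | _ u v =>
    exact SimpleGraph.adj_and_reachable_delete_edges_iff_exists_cycle.1
      ⟨he, hK.reachable_deleteEdges he⟩

theorem exists_nonIntegralCycles (hK : (nonIntegralGraph G x).IsCycles)
    (hodd : ∀ (v : V) (p : (nonIntegralGraph G x).Walk v v), p.IsCycle → Odd p.length) :
    ∃ 𝒞 : Set G.Subgraph, NonIntegralCycles G x 𝒞 := by
  have hle := nonIntegralGraph_le G x
  refine ⟨{C | ∃ (v : V) (p : (nonIntegralGraph G x).Walk v v), p.IsCycle ∧
    (p.mapLe hle).toSubgraph = C}, ⟨?_, ?_, fun e he => ⟨fun hi => ?_, ?_⟩⟩⟩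
  · rintro _ ⟨v, p, hp, rfl⟩
    exact ⟨v, p.mapLe hle, hp.mapLe hle, by simpa using hodd v p hp, rfl⟩
  · rintro _ ⟨u, p, hp, rfl⟩ _ ⟨v, q, hq, rfl⟩ hne
    rw [Set.disjoint_left]
    simp only [SimpleGraph.Walk.mem_verts_toSubgraph, SimpleGraph.Walk.support_mapLe_eq_support]
    intro z hzp hzq
    refine hne ?_
    rw [SimpleGraph.Walk.mapLe, SimpleGraph.Walk.mapLe, SimpleGraph.Walk.toSubgraph_map,
      SimpleGraph.Walk.toSubgraph_map, toSubgraph_eq_of_isCycles hK hp hq hzp hzq]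
  · obtain ⟨v, p, hp, hep⟩ :=
      exists_mem_edges_of_isCycles hK (mem_edgeSet_nonIntegralGraph.2 ⟨he, hi⟩)
    exact ⟨_, ⟨v, p, hp, rfl⟩, by simpa using hep⟩
  · rintro ⟨_, ⟨v, p, -, rfl⟩, hep⟩
    rw [SimpleGraph.Walk.mem_edges_toSubgraph, SimpleGraph.Walk.edges_mapLe_eq_edges] at hep
    exact (mem_edgeSet_nonIntegralGraph.1 (p.edges_subset_edgeSet hep)).2

end NonIntegralCycles

section Modification

variable {V : Type*} {G : SimpleGraph V} {x : Sym2 V → ℝ} {u v : V}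

theorem IsModificationTrail.modifyStep {p : (nonIntegralGraph G x).Walk u v}
    (hp : IsModificationTrail p) : ModifyStep G x (x + alternatingVector p.edges) :=
  ⟨u, v, p, hp.isTrail, hp.ends, (alternate_eq_add x p.edges).symm⟩

theorem IsHalfIntegral.abs_alternatingVector_le (hx : IsHalfIntegral G x)
    (h0 : ∀ e ∈ G.edgeSet, 0 ≤ x e) {T : List (Sym2 V)}
    (hT : ∀ e ∈ T, e ∈ (nonIntegralGraph G x).edgeSet) {e : Sym2 V} (he : e ∈ G.edgeSet) :
    |alternatingVector T e| ≤ x e := by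
  by_cases heT : e ∈ T
  · rw [abs_alternatingVector heT]
    exact hx.half_le h0 (hT e heT)
  · rw [alternatingVector_of_notMem heT, abs_zero]
    exact h0 e he

theorem ncard_edgeSet_add_alternatingVector_lt [Finite V] (hx : IsHalfIntegral G x)
    {p : (nonIntegralGraph G x).Walk u v} (hp : ¬ p.Nil) :
    (nonIntegralGraph G (x + alternatingVector p.edges)).edgeSet.ncard <
      (nonIntegralGraph G x).edgeSet.ncard := by
  rw [edgeSet_nonIntegralGraph_add_alternatingVector hx fun _ he => p.edges_subset_edgeSet he]
  have hmem : s(u, p.snd) ∈ p.edges := p.mk_start_snd_mem_edges hp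
  exact Set.ncard_lt_ncard (Set.sdiff_ssubset_left_iff.2 ⟨_, p.edges_subset_edgeSet hmem, hmem⟩)

theorem exists_nonIntegralCycles_of_forall_isModificationTrail_nil [Finite V]
    (h : ∀ ⦃u v : V⦄ (p : (nonIntegralGraph G x).Walk u v), IsModificationTrail p → p.Nil) :
    ∃ 𝒞 : Set G.Subgraph, NonIntegralCycles G x 𝒞 := by
  refine exists_nonIntegralCycles (isCycles_of_forall_isModificationTrail_nil h) fun v p hp => ?_
  rw [← Nat.not_even_iff_odd]
  exact fun heven => hp.not_nil (h p ⟨hp.isTrail, Or.inr ⟨rfl, heven⟩⟩)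

variable [Fintype V] {b : V → ℕ} {w : Sym2 V → ℝ}

theorem IsModificationTrail.abs_load_le {p : (nonIntegralGraph G x).Walk u v}
    (hp : IsModificationTrail p) (hx : IsHalfIntegral G x) {i : V} (hi : load G x i ≤ b i) :
    |load G (alternatingVector p.edges) i| ≤ b i - load G x i := by
  classical
  rw [load_alternatingVector (nonIntegralGraph_le G x) hp.isTrail]
  rcases hp.ends with ⟨huv, hu, hv⟩ | ⟨rfl, heven⟩
  · by_cases hiuv : i = u ∨ i = v
    · have hodd : Odd ((nonIntegralGraph G x).degree i) := by
        rw [← ncard_neighborSet]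
        rcases hiuv with rfl | rfl <;> assumption
      have hslack := hx.load_add_half_le hi hodd
      have hhalf : |((-1) ^ p.length * (Pi.single i 1 : V → ℝ) v - (Pi.single i 1 : V → ℝ) u) / 2|
          = 1 / 2 := by
        rcases hiuv with rfl | rfl
        · simp [huv.symm, abs_div]
        · simp [huv, abs_div]
      linarith
    · push Not at hiuv
      simpa [hiuv.1.symm, hiuv.2.symm] using hi
  · simpa [heven.neg_one_pow] using hi

theorem IsModificationTrail.isMax_add {p : (nonIntegralGraph G x).Walk u v}
    (hp : IsModificationTrail p) (hx : IsMaxFractionalBMatching G b w x)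
    (hhalf : IsHalfIntegral G x) :
    IsMaxFractionalBMatching G b w (x + alternatingVector p.edges) :=
  hx.add
    (fun _ he => hhalf.abs_alternatingVector_le hx.1.2 (fun _ he => p.edges_subset_edgeSet he) he)
    fun i => hp.abs_load_le hhalf (hx.1.1 i)

theorem exists_modification (hx : IsMaxFractionalBMatching G b w x) (hhalf : IsHalfIntegral G x) :
    ∃ (x' : Sym2 V → ℝ) (𝒞 : Set G.Subgraph), Relation.ReflTransGen (ModifyStep G) x x' ∧
      IsMaxFractionalBMatching G b w x' ∧ IsHalfIntegral G x' ∧ NonIntegralCycles G x' 𝒞 := by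
  induction hn : (nonIntegralGraph G x).edgeSet.ncard using Nat.strong_induction_on
    generalizing x with
  | _ n ih =>
    by_cases htrail : ∃ (u v : V) (p : (nonIntegralGraph G x).Walk u v),
      IsModificationTrail p ∧ ¬ p.Nil
    · obtain ⟨u, v, p, hp, hnil⟩ := htrail
      obtain ⟨x', 𝒞, hsteps, hx'⟩ :=
        ih _ (hn ▸ ncard_edgeSet_add_alternatingVector_lt hhalf hnil) (hp.isMax_add hx hhalf)
          (hhalf.add (isHalfIntegral_alternatingVector G _)) rfl
      exact ⟨x', 𝒞, .head hp.modifyStep hsteps, hx'⟩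
    · push Not at htrail
      obtain ⟨𝒞, h𝒞⟩ := exists_nonIntegralCycles_of_forall_isModificationTrail_nil htrail
      exact ⟨x, 𝒞, .refl, hx, hhalf, h𝒞⟩

end Modification

section OddCycles

variable {V : Type*} {G : SimpleGraph V} {C : G.Subgraph}

theorem ncard_verts_toSubgraph {v : V} {p : G.Walk v v} (hp : p.IsCycle) :
    p.toSubgraph.verts.ncard = p.length := by
  classical
  have hverts : p.toSubgraph.verts = p.support.tail.toFinset := by
    ext u
    rw [SimpleGraph.Walk.mem_verts_toSubgraph, List.coe_toFinset]
    refine ⟨fun hu => ?_, List.mem_of_mem_tail⟩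
    rcases p.mem_support_iff.1 hu with rfl | hu
    · exact p.end_mem_tail_support hp.not_nil
    · exact hu
  rw [hverts, Set.ncard_coe_finset, List.toFinset_card_of_nodup hp.support_nodup]
  simp

theorem cycleLength_toSubgraph {v : V} {p : G.Walk v v} (hp : p.IsCycle) :
    cycleLength p.toSubgraph = p.length := by
  classical
  have hedges : p.toSubgraph.edgeSet = p.edges.toFinset := by
    ext e; simp
  rw [cycleLength, hedges, Set.ncard_coe_finset, List.toFinset_card_of_nodup hp.isTrail.edges_nodup,
    SimpleGraph.Walk.length_edges]

theorem IsOddCycle.three_le_cycleLength (hC : IsOddCycle C) : 3 ≤ cycleLength C := by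
  obtain ⟨v, p, hp, -, rfl⟩ := hC
  rw [cycleLength_toSubgraph hp]
  exact hp.three_le_length

theorem IsOddCycle.exists_mem_edgeSet (hC : IsOddCycle C) {i : V} (hi : i ∈ C.verts) :
    ∃ e ∈ C.edgeSet, i ∈ e := by
  obtain ⟨v, p, hp, -, rfl⟩ := hC
  rw [SimpleGraph.Walk.mem_verts_toSubgraph,
    SimpleGraph.Walk.mem_support_iff_exists_mem_edges_of_not_nil hp.not_nil] at hi
  simpa using hi

/-- The average over the vertices of the cycle `C` of a vertex vector `y`; it is the total amount
withheld by the mechanism from the vertices of `C`. -/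
noncomputable def cycleMean (y : V → ℝ) (C : G.Subgraph) : ℝ :=
  ∑ᶠ i ∈ C.verts, y i / cycleLength C

theorem exists_mem_verts_le_cycleMean {v : V} {p : G.Walk v v} (hp : p.IsCycle) (y : V → ℝ) :
    ∃ u ∈ p.toSubgraph.verts, y u ≤ cycleMean y p.toSubgraph := by
  classical
  have hverts : p.toSubgraph.verts = p.support.toFinset := by
    ext; simp
  have hcard : p.support.toFinset.card = p.length := by
    rw [← ncard_verts_toSubgraph hp, hverts, Set.ncard_coe_finset]
  have hlen : (0 : ℝ) < p.length := by
    exact_mod_cast three_pos.trans_le hp.three_le_length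
  rw [cycleMean, cycleLength_toSubgraph hp, hverts, finsum_mem_coe_finset, ← Finset.sum_div]
  refine Finset.exists_le_of_sum_le ⟨v, by simp⟩ (le_of_eq ?_)
  rw [Finset.sum_const, nsmul_eq_mul, hcard]
  field_simp

theorem IsOddCycle.exists_start_le_cycleMean (hC : IsOddCycle C) (y : V → ℝ) :
    ∃ (v : V) (p : G.Walk v v), p.IsCycle ∧ Odd p.length ∧ C = p.toSubgraph ∧
      y v ≤ cycleMean y C := by
  classical
  obtain ⟨v, p, hp, hodd, rfl⟩ := hC
  obtain ⟨u, hu, hle⟩ := exists_mem_verts_le_cycleMean hp y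
  rw [SimpleGraph.Walk.mem_verts_toSubgraph] at hu
  exact ⟨u, p.rotate u hu, hp.rotate hu, by simpa using hodd, (p.toSubgraph_rotate hu).symm, hle⟩

end OddCycles

section Rounding

variable {V : Type*} {G : SimpleGraph V} {b : V → ℕ} {w x : Sym2 V → ℝ} {y : V → ℝ}
  {𝒞 : Set G.Subgraph} {C : G.Subgraph}

theorem NonIntegralCycles.mem_edgeSet (h𝒞 : NonIntegralCycles G x 𝒞) (hC : C ∈ 𝒞) {e : Sym2 V}
    (he : e ∈ C.edgeSet) : e ∈ (nonIntegralGraph G x).edgeSet :=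
  have heG : e ∈ G.edgeSet := C.edgeSet_subset he
  mem_edgeSet_nonIntegralGraph.2 ⟨heG, (h𝒞.edges e heG).2 ⟨C, hC, he⟩⟩

theorem NonIntegralCycles.disjoint_edgeSet (h𝒞 : NonIntegralCycles G x 𝒞) (hC : C ∈ 𝒞)
    {D : G.Subgraph} (hD : D ∈ 𝒞) (hne : C ≠ D) : Disjoint C.edgeSet D.edgeSet := by
  rw [Set.disjoint_left]
  intro e heC heD
  induction e with
  | _ u v =>
    exact Set.disjoint_left.1 (h𝒞.disjoint C hC D hD hne) (C.edge_vert heC) (D.edge_vert heD)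

theorem NonIntegralCycles.add_alternatingVector (hx : IsHalfIntegral G x)
    (h𝒞 : NonIntegralCycles G x (insert C 𝒞)) (hC : C ∉ 𝒞) {T : List (Sym2 V)}
    (hT : ∀ e, e ∈ T ↔ e ∈ C.edgeSet) : NonIntegralCycles G (x + alternatingVector T) 𝒞 := by
  refine ⟨fun D hD => h𝒞.oddCycle D (.inr hD),
    fun D hD E hE => h𝒞.disjoint D (.inr hD) E (.inr hE), fun e he => ?_⟩
  have hnew : ¬ IsInteger ((x + alternatingVector T) e) ↔ ¬ IsInteger (x e) ∧ e ∉ C.edgeSet := by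
    have h := edgeSet_nonIntegralGraph_add_alternatingVector hx fun e he =>
      h𝒞.mem_edgeSet (.inl rfl) ((hT e).1 he)
    simpa [mem_edgeSet_nonIntegralGraph, he, hT] using Set.ext_iff.1 h e
  rw [hnew, h𝒞.edges e he]
  constructor
  · rintro ⟨⟨D, rfl | hD, heD⟩, heC⟩
    · exact absurd heD heC
    · exact ⟨D, hD, heD⟩
  · rintro ⟨D, hD, heD⟩
    have hne : D ≠ C := ne_of_mem_of_not_mem hD hC
    exact ⟨⟨D, .inr hD, heD⟩,
      Set.disjoint_left.1 (h𝒞.disjoint_edgeSet (.inr hD) (.inl rfl) hne) heD⟩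

variable [Fintype V]

theorem IsFractionalBMatching.add_alternatingVector_of_odd (hx : IsFractionalBMatching G b x)
    (hhalf : IsHalfIntegral G x) {v : V} {p : G.Walk v v} (hp : p.IsTrail) (hodd : Odd p.length)
    (hpx : ∀ e ∈ p.edges, e ∈ (nonIntegralGraph G x).edgeSet) :
    IsFractionalBMatching G b (x + alternatingVector p.edges) := by
  classical
  refine ⟨fun i => ?_, fun e he => ?_⟩
  · have hsingle : 0 ≤ (Pi.single i 1 : V → ℝ) := Pi.single_nonneg.2 zero_le_one
    rw [load_add, load_alternatingVector le_rfl hp, hodd.neg_one_pow]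
    linarith [hx.1 i, show 0 ≤ (Pi.single i 1 : V → ℝ) v from hsingle v]
  · have := hhalf.abs_alternatingVector_le hx.2 hpx he
    rw [Pi.add_apply]
    linarith [neg_le_of_abs_le this]

theorem weight_alternatingVector_of_odd {v : V} {p : G.Walk v v} (hp : p.IsTrail)
    (hodd : Odd p.length) (hwy : ∀ e ∈ p.edges, w e = endSum y e) :
    weight G w (alternatingVector p.edges) = -y v := by
  have hw : weight G w (alternatingVector p.edges) =
      weight G (endSum y) (alternatingVector p.edges) :=
    weight_congr fun e _ => by
      by_cases he : e ∈ p.edges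
      · rw [hwy e he]
      · simp [alternatingVector_of_notMem he]
  rw [hw, weight_endSum_alternatingVector le_rfl y hp, hodd.neg_one_pow]
  ring

theorem IsFractionalBMatching.exists_isBMatching (hx : IsFractionalBMatching G b x)
    (hint : ∀ e ∈ G.edgeSet, IsInteger (x e)) :
    ∃ z : Sym2 V → ℤ, IsBMatching G b z ∧ weight G w (fun e => (z e : ℝ)) = weight G w x := by
  have hfloor : ∀ e ∈ G.edgeSet, x e = ⌊x e⌋ := fun e he => by
    obtain ⟨n, hn⟩ := hint e he
    rw [hn, Int.floor_intCast]
  exact ⟨fun e => ⌊x e⌋, hx.congr hfloor, weight_congr fun e he => by rw [← hfloor e he]⟩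

theorem exists_isBMatching_of_nonIntegralCycles (hx : IsFractionalBMatching G b x)
    (hhalf : IsHalfIntegral G x) (h𝒞 : NonIntegralCycles G x 𝒞)
    (hwy : ∀ e ∈ (nonIntegralGraph G x).edgeSet, w e = endSum y e) :
    ∃ z : Sym2 V → ℤ, IsBMatching G b z ∧
      weight G w x - ∑ᶠ C ∈ 𝒞, cycleMean y C ≤ weight G w fun e => (z e : ℝ) := by
  induction 𝒞, Set.toFinite 𝒞 using Set.Finite.induction_on generalizing x with
  | empty =>
    have hint : ∀ e ∈ G.edgeSet, IsInteger (x e) := fun e he => by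
      simpa using h𝒞.edges e he
    obtain ⟨z, hz, hzw⟩ := hx.exists_isBMatching (w := w) hint
    exact ⟨z, hz, by simp [hzw]⟩
  | @insert C 𝒞 hC hfin ih =>
    obtain ⟨v, p, hp, hodd, hCp, hv⟩ :=
      (h𝒞.oddCycle C (.inl rfl)).exists_start_le_cycleMean y
    have hpC : ∀ e, e ∈ p.edges ↔ e ∈ C.edgeSet := fun e => by
      rw [hCp, SimpleGraph.Walk.mem_edges_toSubgraph]
    have hpx : ∀ e ∈ p.edges, e ∈ (nonIntegralGraph G x).edgeSet := fun e he =>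
      h𝒞.mem_edgeSet (.inl rfl) ((hpC e).1 he)
    obtain ⟨z, hz, hzw⟩ := ih (hx.add_alternatingVector_of_odd hhalf hp.isTrail hodd hpx)
      (hhalf.add (isHalfIntegral_alternatingVector G _)) (h𝒞.add_alternatingVector hhalf hC hpC)
      fun e he => hwy e <| by
        rw [edgeSet_nonIntegralGraph_add_alternatingVector hhalf hpx] at he
        exact he.1
    have hw := weight_alternatingVector_of_odd hp.isTrail hodd fun e he => hwy e (hpx e he)
    refine ⟨z, hz, ?_⟩
    rw [← weightFunctional_apply, map_add, weightFunctional_apply, weightFunctional_apply] at hzw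
    rw [finsum_mem_insert _ hC hfin]
    linarith

end Rounding

section Allocation

variable {V : Type*} [Fintype V] {G : SimpleGraph V} {b : V → ℕ} {x : Sym2 V → ℝ} {y : V → ℝ}
  {𝒞 : Set G.Subgraph} {C : G.Subgraph} {i : V}

theorem allocation_of_notMem (hi : ∀ C ∈ 𝒞, i ∉ C.verts) : allocation b y 𝒞 i = b i * y i := by
  rw [allocation, dif_neg]
  rintro ⟨C, hC, hiC⟩
  exact hi C hC hiC

theorem NonIntegralCycles.allocation_eq (h𝒞 : NonIntegralCycles G x 𝒞) (hC : C ∈ 𝒞)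
    (hi : i ∈ C.verts) :
    allocation b y 𝒞 i = (1 - 1 / ((cycleLength C : ℝ) * b i)) * (b i * y i) := by
  have h : ∃ C ∈ 𝒞, i ∈ C.verts := ⟨C, hC, hi⟩
  have hchoose : h.choose = C := by
    by_contra hne
    exact Set.disjoint_left.1 (h𝒞.disjoint _ h.choose_spec.1 _ hC hne) h.choose_spec.2 hi
  rw [allocation, dif_pos h, hchoose]

theorem one_le_capacity (hx : IsFractionalBMatching G b x) (hhalf : IsHalfIntegral G x)
    (h𝒞 : NonIntegralCycles G x 𝒞) (hC : C ∈ 𝒞) (hi : i ∈ C.verts) : 1 ≤ b i := by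
  obtain ⟨e, he, hie⟩ := (h𝒞.oddCycle C hC).exists_mem_edgeSet hi
  have hhalf_le := hhalf.half_le hx.2 (h𝒞.mem_edgeSet hC he)
  have hle := (le_load hx.2 (C.edgeSet_subset he) hie).trans (hx.1 i)
  have hpos : (0 : ℝ) < b i := by linarith
  exact_mod_cast hpos

theorem sum_allocation (hx : IsFractionalBMatching G b x) (hhalf : IsHalfIntegral G x)
    (h𝒞 : NonIntegralCycles G x 𝒞) :
    ∑ i, allocation b y 𝒞 i = ∑ i, (b i : ℝ) * y i - ∑ᶠ C ∈ 𝒞, cycleMean y C := by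
  have hloss : ∀ C ∈ 𝒞, ∀ i ∈ C.verts,
      b i * y i - allocation b y 𝒞 i = y i / cycleLength C := fun C hC i hi => by
    have hb : (b i : ℝ) ≠ 0 := by
      exact_mod_cast Nat.one_le_iff_ne_zero.1 (one_le_capacity hx hhalf h𝒞 hC hi)
    have hl : (cycleLength C : ℝ) ≠ 0 := by
      exact_mod_cast (three_pos.trans_le (h𝒞.oddCycle C hC).three_le_cycleLength).ne'
    rw [h𝒞.allocation_eq hC hi]
    field_simp
    ring
  have hsupport : Function.support (fun i => b i * y i - allocation b y 𝒞 i) ⊆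
      ⋃ C ∈ 𝒞, C.verts := fun i hi => by
    by_contra hmem
    simp only [Set.mem_iUnion, not_exists] at hmem
    exact hi (sub_eq_zero.2 (allocation_of_notMem hmem).symm)
  have hsum : ∑ i, (b i * y i - allocation b y 𝒞 i) = ∑ᶠ C ∈ 𝒞, cycleMean y C := by
    rw [← finsum_eq_sum_of_fintype, ← finsum_mem_univ,
      finsum_mem_inter_support_eq' _ _ _ fun i hi => iff_of_true (Set.mem_univ i) (hsupport hi),
      finsum_mem_biUnion (fun C hC D hD => h𝒞.disjoint C hC D hD) (Set.toFinite _)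
        fun _ _ => Set.toFinite _]
    exact finsum_mem_congr rfl fun C hC => finsum_mem_congr rfl (hloss C hC)
  rw [← hsum, Finset.sum_sub_distrib, sub_sub_cancel]

end Allocation

section ApproximationFactor

variable {l m β c : ℕ∞}

theorem factor_le_one : factor l β ≤ 1 :=
  sub_le_self _ ENNReal.toReal_nonneg

theorem factor_natCast (l β : ℕ) : factor l β = 1 - 1 / ((l : ℝ) * β) := by
  rw [factor, ENNReal.toReal_inv, one_div]
  norm_cast

theorem factor_mono (hl : l ≠ 0) (hβ : β ≠ 0) (hlm : l ≤ m) (hβc : β ≤ c) :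
    factor l β ≤ factor m c := by
  have hne : ((l * β : ℕ∞) : ℝ≥0∞) ≠ 0 := by
    rw [ne_eq, ENat.toENNReal_eq_zero]
    exact mul_ne_zero hl hβ
  refine sub_le_sub_left (ENNReal.toReal_mono (ENNReal.inv_ne_top.2 hne) ?_) 1
  exact ENNReal.inv_le_inv.2 (ENat.toENNReal_le.2 (mul_le_mul' hlm hβc))

theorem factor_pos (hl : 2 ≤ l) (hβ : 1 ≤ β) : 0 < factor l β := by
  refine lt_of_lt_of_le ?_ (factor_mono (l := (2 : ℕ)) (β := (1 : ℕ)) (by simp) (by simp) hl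
    (by simpa using hβ))
  rw [factor_natCast]
  norm_num

end ApproximationFactor

section ApproximateCore

variable {V : Type*} {G : SimpleGraph V} {b : V → ℕ} {w x : Sym2 V → ℝ} {y : V → ℝ}
  {𝒞 : Set G.Subgraph} {l β : ℕ∞}

theorem inducedSubgraph_univ (G : SimpleGraph V) : inducedSubgraph G Set.univ = G := by
  ext u v
  simp [inducedSubgraph]

theorem IsFractionalCover.inducedSubgraph (hy : IsFractionalCover G w y) (S : Set V) :
    IsFractionalCover (inducedSubgraph G S) w (S.indicator y) :=
  ⟨fun i j hij => by simpa [hij.2.1, hij.2.2] using hy.1 i j hij.1,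
    Set.indicator_nonneg fun i _ => hy.2 i⟩

theorem two_le_minLength (h𝒞 : ∀ C ∈ 𝒞, IsOddCycle C) : 2 ≤ minLength 𝒞 :=
  le_iInf₂ fun C hC => by exact_mod_cast Nat.le_of_succ_le (h𝒞 C hC).three_le_cycleLength

variable [Fintype V]

theorem factor_mul_le_allocation (hl : l ≠ 0) (hβ : β ≠ 0) (hlen : ∀ C ∈ 𝒞, l ≤ cycleLength C)
    (hcap : ∀ C ∈ 𝒞, ∀ i ∈ C.verts, β ≤ b i) {i : V} (hi : 0 ≤ y i) :
    factor l β * (b i * y i) ≤ allocation b y 𝒞 i := by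
  have hby : 0 ≤ b i * y i := mul_nonneg (Nat.cast_nonneg _) hi
  rw [allocation]
  split_ifs with h
  · obtain ⟨hC, hiC⟩ := h.choose_spec
    rw [← factor_natCast]
    exact mul_le_mul_of_nonneg_right (factor_mono hl hβ (hlen _ hC) (hcap _ hC i hiC)) hby
  · exact mul_le_of_le_one_left hby factor_le_one

theorem gamma_le_sum (hy : IsFractionalCover G w y) (S : Finset V) :
    gamma G b w S ≤ ∑ i ∈ S, (b i : ℝ) * y i := by
  classical
  obtain ⟨z, hz, hzw⟩ := (gamma_isGreatest G b w S).1
  rw [← hzw]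
  refine (weight_le_sum hz (hy.inducedSubgraph S)).trans_eq ?_
  simp [Set.indicator_apply]

theorem weight_le_gamma_univ {z : Sym2 V → ℤ} (hz : IsBMatching G b z) :
    weight G w (fun e => (z e : ℝ)) ≤ gamma G b w Set.univ :=
  (gamma_isGreatest G b w Set.univ).2 ⟨z, by rw [inducedSubgraph_univ]; exact ⟨hz, rfl⟩⟩

theorem sum_allocation_le_gamma (hx : IsMaxFractionalBMatching G b w x)
    (hhalf : IsHalfIntegral G x) (h𝒞 : NonIntegralCycles G x 𝒞)
    (hy : IsMinFractionalCover G b w y) :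
    ∑ i, allocation b y 𝒞 i ≤ gamma G b w Set.univ := by
  have hxy := hy.weight_eq hx
  have htight : ∀ e ∈ (nonIntegralGraph G x).edgeSet, w e = endSum y e := fun e he =>
    eq_endSum_of_pos hx.1 hy.1 hxy (mem_edgeSet_nonIntegralGraph.1 he).1
      (one_half_pos.trans_le (hhalf.half_le hx.1.2 he))
  obtain ⟨z, hz, hzw⟩ := exists_isBMatching_of_nonIntegralCycles hx.1 hhalf h𝒞 htight
  rw [sum_allocation hx.1 hhalf h𝒞, ← hxy]
  exact hzw.trans (weight_le_gamma_univ hz)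

theorem one_le_minCapacityOn (hx : IsFractionalBMatching G b x) (hhalf : IsHalfIntegral G x)
    (h𝒞 : NonIntegralCycles G x 𝒞) : 1 ≤ minCapacityOn b 𝒞 :=
  le_iInf₂ fun _ hC => le_iInf₂ fun _ hi => by exact_mod_cast one_le_capacity hx hhalf h𝒞 hC hi

theorem inApproxCore_allocation (hx : IsMaxFractionalBMatching G b w x)
    (hhalf : IsHalfIntegral G x) (h𝒞 : NonIntegralCycles G x 𝒞)
    (hy : IsMinFractionalCover G b w y) (hl : 2 ≤ l) (hβ : 1 ≤ β)
    (hlen : ∀ C ∈ 𝒞, l ≤ cycleLength C) (hcap : ∀ C ∈ 𝒞, ∀ i ∈ C.verts, β ≤ b i) :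
    InApproxCore G b w (factor l β) (allocation b y 𝒞) := by
  have hpos : 0 < factor l β := factor_pos hl hβ
  have hge (i : V) : factor l β * (b i * y i) ≤ allocation b y 𝒞 i :=
    factor_mul_le_allocation (two_pos.trans_le hl).ne' (one_pos.trans_le hβ).ne' hlen hcap
      (hy.1.2 i)
  refine ⟨hpos, factor_le_one, fun i => le_trans ?_ (hge i),
    sum_allocation_le_gamma hx hhalf h𝒞 hy, fun S => ?_⟩
  · exact mul_nonneg hpos.le (mul_nonneg (Nat.cast_nonneg _) (hy.1.2 i))
  · calc factor l β * gamma G b w S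
        ≤ factor l β * ∑ i ∈ S, (b i : ℝ) * y i := by gcongr; exact gamma_le_sum hy.1 S
      _ = ∑ i ∈ S, factor l β * (b i * y i) := Finset.mul_sum ..
      _ ≤ ∑ i ∈ S, allocation b y 𝒞 i := Finset.sum_le_sum fun i _ => hge i

end ApproximateCore

end BMatchingGame

theorem theorem3p2 {V : Type*} [Fintype V] (G : SimpleGraph V) (b : V → ℕ) (w : Sym2 V → ℝ) :
    -- the first step is possible
    (∃ (x : Sym2 V → ℝ) (y : V → ℝ), BMatchingGame.IsMaxFractionalBMatching G b w x ∧
      BMatchingGame.IsHalfIntegral G x ∧ BMatchingGame.IsMinFractionalCover G b w y) ∧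
    -- every half-integral optimal solution can be modified by alternating operations
    (∀ x₀ : Sym2 V → ℝ, BMatchingGame.IsMaxFractionalBMatching G b w x₀ →
      BMatchingGame.IsHalfIntegral G x₀ →
      ∃ (x : Sym2 V → ℝ) (𝒞 : Set G.Subgraph),
        Relation.ReflTransGen (BMatchingGame.ModifyStep G) x₀ x ∧
        BMatchingGame.IsMaxFractionalBMatching G b w x ∧ BMatchingGame.IsHalfIntegral G x ∧
        BMatchingGame.NonIntegralCycles G x 𝒞) ∧
    -- for every modified solution and every minimum fractional cover, the resulting allocation
    -- lies in the approximate core, with both factors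
    (∀ (x : Sym2 V → ℝ) (𝒞 : Set G.Subgraph) (y : V → ℝ),
      BMatchingGame.IsMaxFractionalBMatching G b w x → BMatchingGame.IsHalfIntegral G x →
      BMatchingGame.NonIntegralCycles G x 𝒞 → BMatchingGame.IsMinFractionalCover G b w y →
      BMatchingGame.InApproxCore G b w
        (BMatchingGame.factor (BMatchingGame.minLength 𝒞) (BMatchingGame.minCapacityOn b 𝒞))
        (BMatchingGame.allocation b y 𝒞) ∧
      ((∀ v, 1 ≤ b v) →
        BMatchingGame.InApproxCore G b w
          (BMatchingGame.factor (BMatchingGame.minOddCycleLength G) (BMatchingGame.minCapacity b))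
          (BMatchingGame.allocation b y 𝒞))) := by
  refine ⟨?_, fun x₀ hx₀ hhalf₀ => BMatchingGame.exists_modification hx₀ hhalf₀,
    fun x 𝒞 y hx hhalf h𝒞 hy => ⟨?_, fun hb => ?_⟩⟩
  · obtain ⟨x, hx, hhalf⟩ := BMatchingGame.exists_isMax_isHalfIntegral G b w
    obtain ⟨y, hy⟩ := hx.exists_isMinFractionalCover
    exact ⟨x, y, hx, hhalf, hy⟩
  · exact BMatchingGame.inApproxCore_allocation hx hhalf h𝒞 hy
      (BMatchingGame.two_le_minLength h𝒞.oddCycle)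
      (BMatchingGame.one_le_minCapacityOn hx.1 hhalf h𝒞) (fun C hC => iInf₂_le C hC)
      fun C hC i hi => (iInf₂_le C hC).trans (iInf₂_le i hi)
  · exact BMatchingGame.inApproxCore_allocation hx hhalf h𝒞 hy
      (BMatchingGame.two_le_minLength fun _ hC => hC)
      (le_iInf fun i => by exact_mod_cast hb i)
      (fun C hC => iInf₂_le C (h𝒞.oddCycle C hC)) fun _ _ i _ => iInf_le _ i
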